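/- Assume Schanuel's conjecture: if $z_1,\dots,z_n\in\mathbb{C}$ are linearly independent over $\mathbb{Q}$, then the field $\mathbb{Q}(z_1,\dots,z_n,e^{z_1},\dots,e^{z_n})$ has transcendence degree at least $n$ over $\mathbb{Q}$. Let $\mathcal{K}\subset\mathbb{R}$ be a subfield of finite transcendence degree $d$ over $\mathbb{Q}$, let $G_1$ and $G_2$ be connected semisimple linear algebraic groups defined over $\mathcal{K}$, and for $i=1,2$ let $\Gamma_i\subset G_i(\mathcal{K})\subset G_i(\mathbb{R})$ be a discrete (in $G_i(\mathbb{R})$), Zariski-dense, torsion-free subgroup. For a semisimple element $\gamma\in\Gamma_i$ put $$\lambda_{\Gamma_i}(\gamma)=\Big(\sum_{\alpha}(\log|\alpha(\gamma)|)^2\Big)^{1/2},$$ the sum being over all roots $\alpha$ of $G_i$ with respect to an arbitrary maximal $\mathbb{R}$-torus $T$ of $G_i$ containing $\gamma$ (the value does not depend on $T$). Let $\mathcal{F}_2$ be the subfield of $\mathbb{R}$ generated by the numbers $\lambda_{\Gamma_2}(\gamma)$ for all nontrivial semisimple $\gamma\in\Gamma_2$. Let $\gamma_1,\dots,\gamma_m\in\Gamma_1$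 be nontrivial semisimple elements such that: (a) $\gamma_1,\dots,\gamma_m$ are multiplicatively independent, i.e. for some (equivalently, any) choice of maximal $\mathbb{R}$-tori $T_j$ of $G_1$ with $\gamma_j\in T_j(\mathbb{R})$, every relation $\chi_1(\gamma_1)\cdots\chi_m(\gamma_m)=1$ with (complex) characters $\chi_j$ of $T_j$ implies $\chi_1(\gamma_1)=\dots=\chi_m(\gamma_m)=1$; (b) $\gamma_1,\dots,\gamma_m$ are not weakly contained in $\Gamma_2$, i.e. there are no semisimple elements $\delta_1,\dots,\delta_{m_2}\in\Gamma_2$, maximal $\mathbb{R}$-tori $T_j\ni\gamma_j$ of $G_1$ and $S_k\ni\delta_k$ of $G_2$, and characters $\chi_j$ of $T_j$ and $\psi_k$ of $S_k$ such that $$\chi_1(\gamma_1)\cdots\chi_m(\gamma_m)=\psi_1(\delta_1)\cdots\psi_{m_2}(\delta_{m_2})\neq 1.$$ Then the transcendence degree of $\mathcal{F}_2(\lambda_{\Gamma_1}(\gamma_1),\dots,\lambda_{\Gamma_1}(\gamma_m))$ over $\mathcal{F}_2$ is at least $m-d$. -/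

import Mathlib

namespace AlgGrp

/-! Linear algebraic groups in characteristic zero, in the classical language: an algebraic group is
a Zariski-closed subgroup of `GL n ℂ`, and for a field `k` with an embedding into `ℂ` it is a
`k`-group when it is the zero locus of polynomials with coefficients in `k`. -/

/-- The value of a polynomial in the matrix entries at an invertible matrix. -/
noncomputable def evalAt {n : ℕ} {k : Type*} [Field k] [Algebra k ℂ]
    (g : GL (Fin n) ℂ) (p : MvPolynomial (Fin n × Fin n) k) : ℂ :=
  MvPolynomial.aeval (fun ij : Fin n × Fin n => (g : Matrix (Fin n) (Fin n) ℂ) ij.1 ij.2) p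

/-- `S ⊆ GL_n(ℂ)` is the zero locus of a family of polynomials with coefficients in `k`. Since `k` has
characteristic zero, such an `S` is precisely a closed subvariety defined over `k`. -/
def IsDefinedOver {n : ℕ} (k : Type*) [Field k] [Algebra k ℂ] (S : Set (GL (Fin n) ℂ)) : Prop :=
  ∃ P : Set (MvPolynomial (Fin n × Fin n) k), S = {g | ∀ p ∈ P, evalAt g p = 0}

/-- Zariski-closed subsets of `GL_n(ℂ)`. -/
def IsZariskiClosed {n : ℕ} (S : Set (GL (Fin n) ℂ)) : Prop :=
  IsDefinedOver ℂ S

/-- Connectedness in the Zariski topology (for nonempty sets; used for subgroups only). -/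
def IsZariskiConnected {n : ℕ} (S : Set (GL (Fin n) ℂ)) : Prop :=
  ∀ A B : Set (GL (Fin n) ℂ), IsZariskiClosed A → IsZariskiClosed B →
    S ⊆ A ∪ B → S ∩ A ∩ B = ∅ → S ⊆ A ∨ S ⊆ B

/-- `Γ` is Zariski-dense in `G` (for `Γ ≤ G`): a closed set containing `Γ` contains `G`. -/
def IsZariskiDenseIn {n : ℕ} (Γ G : Subgroup (GL (Fin n) ℂ)) : Prop :=
  ∀ A : Set (GL (Fin n) ℂ), IsZariskiClosed A → (Γ : Set (GL (Fin n) ℂ)) ⊆ A →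
    (G : Set (GL (Fin n) ℂ)) ⊆ A

/-- The group `G(k)` of `k`-rational points, as a subgroup of `G = G(ℂ)`. -/
def rationalPoints {n : ℕ} (k : Type*) [Field k] [Algebra k ℂ] (G : Subgroup (GL (Fin n) ℂ)) :
    Subgroup (GL (Fin n) ℂ) :=
  G ⊓ (Matrix.GeneralLinearGroup.map (n := Fin n) (algebraMap k ℂ)).range

/-- A (connected) semisimple algebraic group: a connected algebraic group whose radical is trivial,
that is, whose only connected closed normal solvable subgroup is the trivial one. -/
structure IsSemisimpleGroup {n : ℕ} (G : Subgroup (GL (Fin n) ℂ)) : Prop where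
  closed : IsZariskiClosed (G : Set (GL (Fin n) ℂ))
  connected : IsZariskiConnected (G : Set (GL (Fin n) ℂ))
  radical : ∀ N : Subgroup (GL (Fin n) ℂ), N ≤ G →
    IsZariskiClosed (N : Set (GL (Fin n) ℂ)) → IsZariskiConnected (N : Set (GL (Fin n) ℂ)) →
    (N.subgroupOf G).Normal → Group.IsSolvable N → N = ⊥

/-- Semisimple elements of `GL_n(ℂ)`. -/
def IsSemisimpleElt {n : ℕ} (g : GL (Fin n) ℂ) : Prop :=
  Module.End.IsSemisimple (Matrix.toLin' (g : Matrix (Fin n) (Fin n) ℂ))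

/-- Algebraic tori: connected diagonalizable algebraic groups. -/
structure IsTorus {n : ℕ} (T : Subgroup (GL (Fin n) ℂ)) : Prop where
  closed : IsZariskiClosed (T : Set (GL (Fin n) ℂ))
  connected : IsZariskiConnected (T : Set (GL (Fin n) ℂ))
  diagonalizable : ∃ g : GL (Fin n) ℂ, ∀ t ∈ T,
    ((g * t * g⁻¹ : GL (Fin n) ℂ) : Matrix (Fin n) (Fin n) ℂ).IsDiag

/-- `T` is a maximal `F`-torus of `G`: a maximal torus of `G` which is defined over `F`. -/
structure IsMaximalTorusOver {n : ℕ} (F : Type*) [Field F] [Algebra F ℂ]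
    (G T : Subgroup (GL (Fin n) ℂ)) : Prop where
  maximal : Maximal (fun S : Subgroup (GL (Fin n) ℂ) => IsTorus S ∧ S ≤ G) T
  definedOver : IsDefinedOver F (T : Set (GL (Fin n) ℂ))

/-- The characters of `T`: homomorphisms to `ℂˣ` that are regular functions, i.e. restrictions
to `T` of elements of `ℂ[x_ij, 1 / det]`. -/
def characters {n : ℕ} (T : Subgroup (GL (Fin n) ℂ)) : Set (T →* ℂˣ) :=
  {χ | ∃ (p : MvPolynomial (Fin n × Fin n) ℂ) (k : ℕ), ∀ t : T,
    (χ t : ℂ) * ((t : GL (Fin n) ℂ) : Matrix (Fin n) (Fin n) ℂ).det ^ k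
      = evalAt (t : GL (Fin n) ℂ) p}

/-- The Lie algebra of `G`: the tangent space at the identity, inside `M_n(ℂ)`. -/
def lieAlgebra {n : ℕ} (G : Subgroup (GL (Fin n) ℂ)) : Set (Matrix (Fin n) (Fin n) ℂ) :=
  {X | ∀ p : MvPolynomial (Fin n × Fin n) ℂ, (∀ g ∈ G, evalAt g p = 0) →
    ∑ ij : Fin n × Fin n, X ij.1 ij.2 * evalAt 1 (MvPolynomial.pderiv ij p) = 0}

/-- The roots of `G` with respect to `T`: nontrivial characters of `T` by which `T` acts
on some line of the Lie algebra of `G` under the adjoint representation. -/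
def roots {n : ℕ} (G T : Subgroup (GL (Fin n) ℂ)) : Set (T →* ℂˣ) :=
  {α | α ∈ characters T ∧ α ≠ 1 ∧ ∃ X ∈ lieAlgebra G, X ≠ 0 ∧ ∀ t : T,
    ((t : GL (Fin n) ℂ) : Matrix (Fin n) (Fin n) ℂ) * X
      * (((t : GL (Fin n) ℂ)⁻¹ : GL (Fin n) ℂ) : Matrix (Fin n) (Fin n) ℂ)
      = (α t : ℂ) • X}

/-- `(∑_α (log |α(γ)|)²)^(1/2)`, the sum being over the (finitely many) roots with respect to `T`. -/
noncomputable def lengthWrt {n : ℕ} (G T : Subgroup (GL (Fin n) ℂ)) (γ : T) : ℝ :=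
  Real.sqrt (∑ᶠ α ∈ roots G T, (Real.log ‖((α γ : ℂˣ) : ℂ)‖) ^ 2)

open Classical in
/-- `λ(γ)`, computed in an arbitrary maximal `ℝ`-torus of `G` containing `γ`. The value does not
depend on the torus, because the `α(γ)` are the eigenvalues of `Ad γ` (up to eigenvalues `1`); for a
semisimple element `γ` of `G(ℝ)`, with `G` connected, such a torus exists. -/
noncomputable def lam {n : ℕ} (G : Subgroup (GL (Fin n) ℂ)) (γ : GL (Fin n) ℂ) : ℝ :=
  if h : ∃ T : Subgroup (GL (Fin n) ℂ), IsMaximalTorusOver ℝ G T ∧ γ ∈ T then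
    lengthWrt G h.choose ⟨γ, h.choose_spec.2⟩
  else 0

/-- The subfield of `ℝ` generated by the `λ(γ)`, for all nontrivial semisimple `γ ∈ Γ`. -/
noncomputable def lengthField {n : ℕ} (G Γ : Subgroup (GL (Fin n) ℂ)) : Subfield ℝ :=
  Subfield.closure {x | ∃ γ ∈ Γ, γ ≠ 1 ∧ IsSemisimpleElt γ ∧ x = lam G γ}

/-- Multiplicative independence of `γ₁, …, γₘ ∈ G(F)`: for some maximal `F`-tori `T_j ∋ γ_j`
of `G`, a relation `∏ χ_j(γ_j) = 1` with characters `χ_j` of `T_j` forces all `χ_j(γ_j) = 1`. -/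
def MultiplicativelyIndependent (F : Type*) [Field F] [Algebra F ℂ] {n m : ℕ}
    (G : Subgroup (GL (Fin n) ℂ)) (γ : Fin m → GL (Fin n) ℂ) : Prop :=
  ∃ (T : Fin m → Subgroup (GL (Fin n) ℂ)) (hγ : ∀ j, γ j ∈ T j),
    (∀ j, IsMaximalTorusOver F G (T j)) ∧
    ∀ χ : (j : Fin m) → (T j →* ℂˣ), (∀ j, χ j ∈ characters (T j)) →
      ∏ j, χ j ⟨γ j, hγ j⟩ = 1 → ∀ j, χ j ⟨γ j, hγ j⟩ = 1

/-- The semisimple elements `γ₁, …, γₘ` of `G₁(F)` are weakly contained in `Γ₂ ⊆ G₂(F)`. -/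
def WeaklyContained (F : Type*) [Field F] [Algebra F ℂ] {n₁ n₂ m : ℕ}
    (G₁ : Subgroup (GL (Fin n₁) ℂ)) (G₂ : Subgroup (GL (Fin n₂) ℂ))
    (γ : Fin m → GL (Fin n₁) ℂ) (Γ₂ : Subgroup (GL (Fin n₂) ℂ)) : Prop :=
  ∃ (m₂ : ℕ) (δ : Fin m₂ → GL (Fin n₂) ℂ),
    (∀ k, δ k ∈ Γ₂ ∧ IsSemisimpleElt (δ k)) ∧
    ∃ (T : Fin m → Subgroup (GL (Fin n₁) ℂ)) (hγ : ∀ j, γ j ∈ T j)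
      (S : Fin m₂ → Subgroup (GL (Fin n₂) ℂ)) (hδ : ∀ k, δ k ∈ S k)
      (χ : (j : Fin m) → (T j →* ℂˣ)) (ψ : (k : Fin m₂) → (S k →* ℂˣ)),
      (∀ j, IsMaximalTorusOver F G₁ (T j) ∧ χ j ∈ characters (T j)) ∧
      (∀ k, IsMaximalTorusOver F G₂ (S k) ∧ ψ k ∈ characters (S k)) ∧
      ∏ j, χ j ⟨γ j, hγ j⟩ = ∏ k, ψ k ⟨δ k, hδ k⟩ ∧
      ∏ k, ψ k ⟨δ k, hδ k⟩ ≠ 1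

/-- Schanuel's conjecture. -/
def SchanuelConjecture : Prop :=
  ∀ (n : ℕ) (z : Fin n → ℂ), LinearIndependent ℚ z →
    (n : Cardinal) ≤ Algebra.trdeg ℚ
      (IntermediateField.adjoin ℚ (Set.range z ∪ Set.range (fun i => Complex.exp (z i))))

end AlgGrp

/-! Write `ℓ j α = log |α(γ j)|`, so that `λ(γ j)² = ∑ α, (ℓ j α)²`, and let `W` be the set of all
logarithms of absolute values of root values at semisimple elements of `Γ₂`. Exponentials of all
these numbers are algebraic over `K`, and the length field of `Γ₂` is algebraic over `ℚ(W)`.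
Schanuel's conjecture therefore turns linear independence over `ℚ` into a lower bound for
transcendence degree, at a cost of `d` for the exponentials.

Linear independence comes from the two hypotheses on the `γ j`. At a real point `|χ|²` is itself the
value of a character (`exists_character_normSq`), so an integral relation among logarithms
exponentiates to a relation among character values. Failure of weak containment makes both sides
equal to one, multiplicative independence makes each factor one, and injectivity of the real
exponential finishes (`eq_zero_of_sum_mem_closure`, `eq_zero_of_sum_mem_span`).

The count is `SchanuelConjecture.le_trdeg_add`. Choose a `ℚ`-basis `β j` of the span of the `ℓ j α`.
One element of each `β j` may be traded for `λ(γ j)`, since it solves a quadratic equation over the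
others whose leading coefficient is a nonzero sum of squares (`mem_algClosureField_of_sum_sq`). If
the `λ(γ j)` had transcendence degree `r` over the length field, then `∑ |β j|` independent
logarithms, together with finitely many from `W`, would be governed by `d + r + ∑ (|β j| - 1)`
numbers besides those from `W`; hence `m ≤ d + r`.

The trade needs every `β j` to be nonempty, that is, some root value of `γ j` off the unit circle
(`exists_root_log_ne_zero`). Otherwise the positive part of `γ j` generates a connected closed
central subgroup of `G₁`, trivial by semisimplicity; then `γ j` lies in a compact torus and in a
discrete group, so it has finite order and is trivial. Centrality rests on `commute_of_lieAlgebra`: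
a diagonalizable element acting trivially on the Lie algebra of a connected group is central, by
Krull's intersection theorem. -/

namespace AlgGrp

/-! ### Linear independence of characters and monomial relations -/

section Characters

variable {M ι : Type*} [Monoid M]

/-- If a linear combination of characters vanishes, so does the sum of the coefficients
of each character. -/
lemma sum_filter_eq_zero_of_characters [Fintype ι] [DecidableEq (M →* ℂ)] (χ : ι → M →* ℂ)
    (c : ι → ℂ) (h : ∀ x, ∑ i, c i * χ i x = 0) (χ₀ : M →* ℂ) :
    ∑ i with χ i = χ₀, c i = 0 := by
  have hli := linearIndependent_monoidHom M ℂ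
  rw [linearIndependent_iff'] at hli
  by_cases hχ : χ₀ ∈ Finset.univ.image χ
  · refine hli (Finset.univ.image χ) (fun ψ => ∑ i with χ i = ψ, c i) ?_ χ₀ hχ
    funext x
    rw [Pi.zero_apply, ← h x, Finset.sum_apply, ← Finset.sum_fiberwise_of_maps_to
      (s := Finset.univ) (t := Finset.univ.image χ) (g := χ)
      (fun i _ => Finset.mem_image_of_mem _ (Finset.mem_univ i))]
    refine Finset.sum_congr rfl fun ψ _ => ?_
    rw [Pi.smul_apply, smul_eq_mul, Finset.sum_mul]
    refine Finset.sum_congr rfl fun i hi => ?_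
    rw [(Finset.mem_filter.1 hi).2]
  · refine Finset.sum_eq_zero fun i hi => absurd ?_ hχ
    rw [← (Finset.mem_filter.1 hi).2]
    exact Finset.mem_image_of_mem _ (Finset.mem_univ i)

/-- A combination of characters which vanishes identically stays zero when the characters are
replaced by values that respect equalities among them. -/
lemma sum_eq_zero_of_characters [Fintype ι] (χ : ι → M →* ℂ)
    (c : ι → ℂ) (h : ∀ x, ∑ i, c i * χ i x = 0) (w : ι → ℂ)
    (hw : ∀ i j, χ i = χ j → w i = w j) : ∑ i, c i * w i = 0 := by
  classical
  rw [← Finset.sum_fiberwise_of_maps_to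
      (s := Finset.univ) (t := Finset.univ.image χ) (g := χ)
      (fun i _ => Finset.mem_image_of_mem _ (Finset.mem_univ i))]
  refine Finset.sum_eq_zero fun ψ hψ => ?_
  obtain ⟨j, -, rfl⟩ := Finset.mem_image.1 hψ
  have : ∀ i ∈ Finset.univ.filter (fun i => χ i = χ j), c i * w i = c i * w j := fun i hi => by
    rw [hw i j (Finset.mem_filter.1 hi).2]
  rw [Finset.sum_congr rfl this, ← Finset.sum_mul, sum_filter_eq_zero_of_characters χ c h, zero_mul]

end Characters

/-- A polynomial vanishing at all powers of `x` vanishes at each `y` satisfying all the monomial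
equations satisfied by `x`. -/
lemma eval_eq_zero_of_pow {σ : Type*} [Fintype σ] (p : MvPolynomial σ ℂ) (x y : σ → ℂ)
    (hxy : ∀ e e' : σ →₀ ℕ, ∏ a, x a ^ e a = ∏ a, x a ^ e' a →
      ∏ a, y a ^ e a = ∏ a, y a ^ e' a)
    (h : ∀ k : ℕ, MvPolynomial.eval (x ^ k) p = 0) : MvPolynomial.eval y p = 0 := by
  have key : ∀ z : σ → ℂ, MvPolynomial.eval z p =
      ∑ e : p.support, p.coeff e * ∏ a, z a ^ (e : σ →₀ ℕ) a := fun z => by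
    rw [MvPolynomial.eval_eq', ← Finset.sum_coe_sort]
  rw [key]
  -- Each monomial `e` gives the character `k ↦ (x ^ e) ^ k` of `ℕ`, and the vanishing at all powers
  -- of `x` is a linear relation among these. Monomials giving the same character agree at `x`,
  -- hence at `y`.
  refine sum_eq_zero_of_characters (M := Multiplicative ℕ)
    (fun e : p.support => powersHom ℂ (∏ a, x a ^ (e : σ →₀ ℕ) a)) _ (fun k => ?_) _
    (fun e e' hee => hxy _ _ ((powersHom ℂ).injective hee))
  rw [← h k.toAdd, key]
  refine Finset.sum_congr rfl fun e _ => ?_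
  simp only [powersHom_apply, Pi.pow_apply, ← Finset.prod_pow]
  congr 1
  exact Finset.prod_congr rfl fun a _ => pow_right_comm _ _ _

/-! ### Diagonal matrices in a fixed basis -/

section Diagonal

variable {n : ℕ}

/-- The diagonal matrices in the coordinates given by `g`. -/
def diagHom (g : GL (Fin n) ℂ) : (Fin n → ℂˣ) →* GL (Fin n) ℂ :=
  (MulAut.conj g⁻¹).toMonoidHom.comp
    ((Units.map (Matrix.diagonalRingHom (Fin n) ℂ).toMonoidHom).comp
      (MulEquiv.piUnits (M := fun _ : Fin n => ℂ)).symm.toMonoidHom)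

lemma coe_diagHom (g : GL (Fin n) ℂ) (u : Fin n → ℂˣ) :
    (diagHom g u : Matrix (Fin n) (Fin n) ℂ) =
      ((g⁻¹ : GL (Fin n) ℂ) : Matrix (Fin n) (Fin n) ℂ) * Matrix.diagonal (fun a => (u a : ℂ)) *
        (g : Matrix (Fin n) (Fin n) ℂ) := by
  simp only [diagHom, MonoidHom.comp_apply, MulEquiv.coe_toMonoidHom, MulAut.conj_apply, inv_inv,
    Units.val_mul]
  rfl

lemma conj_diagHom (g : GL (Fin n) ℂ) (u : Fin n → ℂˣ) :
    ((g * diagHom g u * g⁻¹ : GL (Fin n) ℂ) : Matrix (Fin n) (Fin n) ℂ) =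
      Matrix.diagonal (fun a => (u a : ℂ)) := by
  have h : (g : Matrix (Fin n) (Fin n) ℂ) *
      ((g⁻¹ : GL (Fin n) ℂ) : Matrix (Fin n) (Fin n) ℂ) = 1 := by
    rw [← Units.val_mul, mul_inv_cancel, Units.val_one]
  rw [Units.val_mul, Units.val_mul, coe_diagHom, Matrix.mul_assoc, Matrix.mul_assoc,
    Matrix.mul_assoc, h, Matrix.mul_one, ← Matrix.mul_assoc, h, Matrix.one_mul]

lemma exists_diagHom_of_isDiag (g t : GL (Fin n) ℂ)
    (h : ((g * t * g⁻¹ : GL (Fin n) ℂ) : Matrix (Fin n) (Fin n) ℂ).IsDiag) :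
    ∃ u, t = diagHom g u := by
  have hd : ((g * t * g⁻¹ : GL (Fin n) ℂ) : Matrix (Fin n) (Fin n) ℂ) =
      Matrix.diagonal (fun a => (g * t * g⁻¹ : GL (Fin n) ℂ) a a) := h.diagonal_diag.symm
  have hne : ∀ a, (g * t * g⁻¹ : GL (Fin n) ℂ) a a ≠ 0 := by
    have := (Matrix.isUnit_iff_isUnit_det _).1 (g * t * g⁻¹ : GL (Fin n) ℂ).isUnit
    rw [hd, Matrix.det_diagonal, isUnit_iff_ne_zero, Finset.prod_ne_zero_iff] at this
    exact fun a => this a (Finset.mem_univ a)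
  refine ⟨fun a => Units.mk0 _ (hne a), ?_⟩
  have : g * t * g⁻¹ = g * diagHom g (fun a => Units.mk0 _ (hne a)) * g⁻¹ := by
    apply Units.ext
    rw [conj_diagHom]
    exact hd
  simpa using this

lemma diagHom_injective (g : GL (Fin n) ℂ) : Function.Injective (diagHom g) := fun u v h => by
  have := conj_diagHom g u
  rw [h, conj_diagHom] at this
  funext a
  exact Units.ext (congrFun (Matrix.diagonal_injective this) a).symm

/-- The entries of `diagHom g z` are linear forms in `z`, so `p` becomes a polynomial in `z` and
`eval_eq_zero_of_pow` applies. This is how a closed group containing an element is seen to contain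
its positive part. -/
lemma evalAt_diagHom_eq_zero (g : GL (Fin n) ℂ) (p : MvPolynomial (Fin n × Fin n) ℂ)
    (x y : Fin n → ℂˣ)
    (hxy : ∀ e e' : Fin n →₀ ℕ, ∏ a, x a ^ e a = ∏ a, x a ^ e' a →
      ∏ a, y a ^ e a = ∏ a, y a ^ e' a)
    (h : ∀ k : ℕ, evalAt (diagHom g (x ^ k)) p = 0) : evalAt (diagHom g y) p = 0 := by
  let q : MvPolynomial (Fin n) ℂ := MvPolynomial.bind₁ (fun ij : Fin n × Fin n =>
    ∑ a, MvPolynomial.C ((g⁻¹ : GL (Fin n) ℂ) ij.1 a * g a ij.2) * MvPolynomial.X a) p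
  have key : ∀ z : Fin n → ℂˣ,
      evalAt (diagHom g z) p = MvPolynomial.eval (fun a => (z a : ℂ)) q := fun z => by
    rw [← MvPolynomial.coe_aeval_eq_eval, RingHom.coe_coe, MvPolynomial.aeval_bind₁]
    unfold evalAt
    congr 2
    funext ij
    rw [coe_diagHom, Matrix.mul_apply]
    simp only [Matrix.mul_diagonal, map_sum, map_mul, MvPolynomial.aeval_X, MvPolynomial.aeval_C]
    refine Finset.sum_congr rfl fun a _ => ?_
    simp only [Algebra.algebraMap_self, RingHom.id_apply]
    ring
  rw [key]
  refine eval_eq_zero_of_pow q (fun a => (x a : ℂ)) _ (fun e e' hee => ?_) (fun k => ?_)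
  · have := hxy e e' (Units.ext (by simpa using hee))
    simpa using congrArg (Units.val) this
  · rw [← h k, key]
    congr 2

end Diagonal

/-! ### The ideal of a group, its tangent space, and conjugation -/

section Tangent

variable {n : ℕ}

/-- The ideal of polynomials vanishing on `G`. -/
noncomputable def vanishing (G : Subgroup (GL (Fin n) ℂ)) :
    Ideal (MvPolynomial (Fin n × Fin n) ℂ) :=
  ⨅ g ∈ G, RingHom.ker (MvPolynomial.aeval (R := ℂ)
    (fun ij : Fin n × Fin n => (g : Matrix (Fin n) (Fin n) ℂ) ij.1 ij.2))

lemma mem_vanishing {G : Subgroup (GL (Fin n) ℂ)} {p : MvPolynomial (Fin n × Fin n) ℂ} :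
    p ∈ vanishing G ↔ ∀ g ∈ G, evalAt g p = 0 := by
  simp only [vanishing, Submodule.mem_iInf, RingHom.mem_ker]
  rfl

/-- The maximal ideal of the identity matrix. -/
noncomputable def idealOne (n : ℕ) : Ideal (MvPolynomial (Fin n × Fin n) ℂ) :=
  RingHom.ker (MvPolynomial.aeval (R := ℂ)
    (fun ij : Fin n × Fin n => ((1 : GL (Fin n) ℂ) : Matrix (Fin n) (Fin n) ℂ) ij.1 ij.2))

lemma mem_idealOne {p : MvPolynomial (Fin n × Fin n) ℂ} :
    p ∈ idealOne n ↔ evalAt 1 p = 0 := Iff.rfl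

section evalAt

variable {k : Type*} [Field k] [Algebra k ℂ] (g : GL (Fin n) ℂ)
  (p q : MvPolynomial (Fin n × Fin n) k)

lemma evalAt_add : evalAt g (p + q) = evalAt g p + evalAt g q := map_add _ _ _

lemma evalAt_sub : evalAt g (p - q) = evalAt g p - evalAt g q := map_sub _ _ _

lemma evalAt_mul : evalAt g (p * q) = evalAt g p * evalAt g q := map_mul _ _ _

lemma evalAt_prod {ι : Type*} (s : Finset ι) (f : ι → MvPolynomial (Fin n × Fin n) k) :
    evalAt g (∏ i ∈ s, f i) = ∏ i ∈ s, evalAt g (f i) := map_prod _ _ _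

lemma evalAt_pow (m : ℕ) : evalAt g (p ^ m) = evalAt g p ^ m := map_pow _ _ _

lemma evalAt_one : evalAt g (1 : MvPolynomial (Fin n × Fin n) k) = 1 := map_one _

lemma evalAt_C (c : k) : evalAt g (MvPolynomial.C c) = algebraMap k ℂ c :=
  MvPolynomial.aeval_C _ _

lemma evalAt_X (ij : Fin n × Fin n) :
    evalAt g (MvPolynomial.X ij : MvPolynomial (Fin n × Fin n) k) = g ij.1 ij.2 :=
  MvPolynomial.aeval_X _ _

end evalAt

/-- The differential at the identity of a polynomial in the matrix entries. -/
noncomputable def diffOne :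
    MvPolynomial (Fin n × Fin n) ℂ →ₗ[ℂ] Module.Dual ℂ (Matrix (Fin n) (Fin n) ℂ) where
  toFun p :=
    { toFun := fun X => ∑ ij : Fin n × Fin n, X ij.1 ij.2 * evalAt 1 (MvPolynomial.pderiv ij p)
      map_add' := fun X Y => by
        simp only [Matrix.add_apply, add_mul, Finset.sum_add_distrib]
      map_smul' := fun c X => by
        simp only [Matrix.smul_apply, smul_eq_mul, mul_assoc, Finset.mul_sum, RingHom.id_apply] }
  map_add' p q := by
    ext X
    simp only [map_add, evalAt_add, mul_add, Finset.sum_add_distrib, LinearMap.coe_mk,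
      AddHom.coe_mk, LinearMap.add_apply]
  map_smul' c p := by
    ext X
    simp only [MvPolynomial.smul_eq_C_mul, MvPolynomial.pderiv_C_mul, evalAt_mul, evalAt_C,
      LinearMap.coe_mk, AddHom.coe_mk, LinearMap.smul_apply, RingHom.id_apply, smul_eq_mul,
      Finset.mul_sum, Algebra.algebraMap_self]
    exact Finset.sum_congr rfl fun _ _ => by ring

lemma diffOne_apply (p : MvPolynomial (Fin n × Fin n) ℂ) (X : Matrix (Fin n) (Fin n) ℂ) :
    diffOne p X = ∑ ij : Fin n × Fin n, X ij.1 ij.2 * evalAt 1 (MvPolynomial.pderiv ij p) := rfl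

lemma diffOne_C (c : ℂ) (X : Matrix (Fin n) (Fin n) ℂ) :
    diffOne (MvPolynomial.C c) X = 0 := by
  rw [diffOne_apply]
  refine Finset.sum_eq_zero fun ij _ => ?_
  rw [MvPolynomial.pderiv_C, evalAt, map_zero, mul_zero]

lemma diffOne_mul (p q : MvPolynomial (Fin n × Fin n) ℂ) (X : Matrix (Fin n) (Fin n) ℂ) :
    diffOne (p * q) X = evalAt 1 q * diffOne p X + evalAt 1 p * diffOne q X := by
  simp only [diffOne_apply, Finset.mul_sum, ← Finset.sum_add_distrib]
  refine Finset.sum_congr rfl fun ij _ => ?_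
  rw [MvPolynomial.pderiv_mul, evalAt_add, evalAt_mul, evalAt_mul]
  ring

lemma diffOne_X (ij : Fin n × Fin n) (X : Matrix (Fin n) (Fin n) ℂ) :
    diffOne (MvPolynomial.X ij) X = X ij.1 ij.2 := by
  classical
  rw [diffOne_apply, Finset.sum_eq_single ij]
  · rw [MvPolynomial.pderiv_X_self, evalAt_one, mul_one]
  · intro kl _ h
    rw [MvPolynomial.pderiv_X_of_ne h.symm, evalAt, map_zero, mul_zero]
  · simp

lemma mem_lieAlgebra {G : Subgroup (GL (Fin n) ℂ)} {X : Matrix (Fin n) (Fin n) ℂ} :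
    X ∈ lieAlgebra G ↔ ∀ p ∈ vanishing G, diffOne p X = 0 := by
  simp only [mem_vanishing]
  rfl

/-- First order Taylor expansion at the identity. -/
lemma sub_sum_mem_idealOne_sq (p : MvPolynomial (Fin n × Fin n) ℂ) :
    p - MvPolynomial.C (evalAt 1 p) - ∑ ij : Fin n × Fin n,
      MvPolynomial.C (evalAt 1 (MvPolynomial.pderiv ij p)) *
        (MvPolynomial.X ij - MvPolynomial.C ((1 : Matrix (Fin n) (Fin n) ℂ) ij.1 ij.2))
      ∈ idealOne n ^ 2 := by
  classical
  have hX : ∀ ij : Fin n × Fin n, (MvPolynomial.X ij -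
      MvPolynomial.C ((1 : Matrix (Fin n) (Fin n) ℂ) ij.1 ij.2) :
        MvPolynomial (Fin n × Fin n) ℂ) ∈ idealOne n := fun ij => by
    rw [mem_idealOne, evalAt_sub, evalAt_X, evalAt_C]
    simp
  have hev : ∀ p : MvPolynomial (Fin n × Fin n) ℂ,
      p - MvPolynomial.C (evalAt 1 p) ∈ idealOne n := fun p => by
    rw [mem_idealOne, evalAt_sub, evalAt_C]
    simp
  induction p using MvPolynomial.induction_on with
  | C c => simp [evalAt]
  | add p q hp hq =>
    convert add_mem hp hq using 1
    simp only [evalAt_add, map_add, add_mul, Finset.sum_add_distrib]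
    ring
  | mul_X p ij hp =>
    -- With `δ` the `ij` entry of the identity, the remainder of `p * X ij` is `(p - p(1)) * (X ij -
    -- δ)` plus `δ` times the remainder of `p`.
    have h1 := Ideal.mul_mem_mul (hev p) (hX ij)
    rw [← sq] at h1
    have h2 := Ideal.mul_mem_left _
      (MvPolynomial.C ((1 : Matrix (Fin n) (Fin n) ℂ) ij.1 ij.2)) hp
    convert add_mem h1 h2 using 1
    have h3 : ∑ kl : Fin n × Fin n, MvPolynomial.C
          (evalAt 1 (MvPolynomial.pderiv kl (p * MvPolynomial.X ij))) *
        (MvPolynomial.X kl - MvPolynomial.C ((1 : Matrix (Fin n) (Fin n) ℂ) kl.1 kl.2)) =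
        MvPolynomial.C ((1 : Matrix (Fin n) (Fin n) ℂ) ij.1 ij.2) *
          ∑ kl : Fin n × Fin n, MvPolynomial.C (evalAt 1 (MvPolynomial.pderiv kl p)) *
            (MvPolynomial.X kl - MvPolynomial.C ((1 : Matrix (Fin n) (Fin n) ℂ) kl.1 kl.2)) +
        MvPolynomial.C (evalAt 1 p) * (MvPolynomial.X ij -
          MvPolynomial.C ((1 : Matrix (Fin n) (Fin n) ℂ) ij.1 ij.2)) := by
      have h4 : MvPolynomial.C (evalAt 1 p) * (MvPolynomial.X ij -
          MvPolynomial.C ((1 : Matrix (Fin n) (Fin n) ℂ) ij.1 ij.2)) =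
          ∑ kl : Fin n × Fin n, MvPolynomial.C (evalAt 1 p * (Pi.single ij 1 : Fin n × Fin n → ℂ) kl) *
            (MvPolynomial.X kl - MvPolynomial.C ((1 : Matrix (Fin n) (Fin n) ℂ) kl.1 kl.2)) := by
        rw [Finset.sum_eq_single ij]
        · simp
        · intro kl _ h
          simp [Pi.single_eq_of_ne h]
        · simp
      rw [h4, Finset.mul_sum, ← Finset.sum_add_distrib]
      refine Finset.sum_congr rfl fun kl _ => ?_
      rw [MvPolynomial.pderiv_mul, evalAt_add, evalAt_mul, evalAt_mul, evalAt_X,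
        MvPolynomial.pderiv_X]
      have : evalAt (n := n) 1 ((Pi.single kl 1 :
          Fin n × Fin n → MvPolynomial (Fin n × Fin n) ℂ) ij) =
          (Pi.single ij 1 : Fin n × Fin n → ℂ) kl := by
        by_cases h : kl = ij
        · subst h; simp [evalAt_one]
        · simp [Pi.single_eq_of_ne h, Pi.single_eq_of_ne' h, evalAt]
      rw [this, Units.val_one, map_add, map_mul, map_mul]
      ring
    rw [h3, evalAt_mul, evalAt_X, Units.val_one, map_mul]
    ring

/-- The constant and linear terms of the Taylor expansion vanish; testing the differential on matrix
units isolates the partial derivatives. -/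
lemma mem_idealOne_sq {p : MvPolynomial (Fin n × Fin n) ℂ} (h : evalAt 1 p = 0)
    (hd : diffOne p = 0) : p ∈ idealOne n ^ 2 := by
  classical
  have key := sub_sum_mem_idealOne_sq p
  rw [h, map_zero, sub_zero, Finset.sum_eq_zero, sub_zero] at key
  · exact key
  · intro ij _
    have := LinearMap.congr_fun hd (Matrix.single ij.1 ij.2 1)
    rw [diffOne_apply, Finset.sum_eq_single ij] at this
    · simp only [Matrix.single_apply_same, one_mul, LinearMap.zero_apply] at this
      rw [this, map_zero, zero_mul]
    · intro kl _ hne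
      rw [Matrix.single_apply_of_ne, zero_mul]
      rintro ⟨h1, h2⟩
      exact hne (Prod.ext h1.symm h2.symm)
    · simp

/-- A polynomial vanishing at the identity whose differential vanishes on the Lie algebra lies in
the square of the maximal ideal of the identity, modulo the ideal of `G`. -/
lemma mem_sq_sup_vanishing {G : Subgroup (GL (Fin n) ℂ)} {p : MvPolynomial (Fin n × Fin n) ℂ}
    (h : evalAt 1 p = 0) (hd : ∀ X ∈ lieAlgebra G, diffOne p X = 0) :
    p ∈ idealOne n ^ 2 ⊔ vanishing G := by
  let W : Subspace ℂ (Module.Dual ℂ (Matrix (Fin n) (Fin n) ℂ)) :=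
    ((vanishing G).restrictScalars ℂ).map diffOne
  have hp : diffOne p ∈ W := by
    -- The Lie algebra is the common kernel of `W`, so by finite-dimensional duality a form
    -- vanishing on it is the differential of some element of the ideal of `G`.
    rw [← Subspace.dualCoannihilator_dualAnnihilator_eq (W := W), Submodule.mem_dualAnnihilator]
    intro X hX
    refine hd X (mem_lieAlgebra.2 fun q hq => ?_)
    exact (Submodule.mem_dualCoannihilator X).1 hX _ (Submodule.mem_map_of_mem hq)
  obtain ⟨q, hq, hqp⟩ := hp
  have hq' : q ∈ vanishing G := hq
  have : p - q ∈ idealOne n ^ 2 := by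
    refine mem_idealOne_sq ?_ ?_
    · rw [evalAt_sub, h, mem_vanishing.1 hq' 1 G.one_mem, sub_zero]
    · rw [map_sub, hqp, sub_self]
  rw [← sub_add_cancel p q]
  exact add_mem (Ideal.mem_sup_left this) (Ideal.mem_sup_right hq')

/-- The action of conjugation by `h` on polynomials in the matrix entries. -/
noncomputable def conjPoly (h : GL (Fin n) ℂ) :
    MvPolynomial (Fin n × Fin n) ℂ →ₐ[ℂ] MvPolynomial (Fin n × Fin n) ℂ :=
  MvPolynomial.bind₁ fun ij => ∑ a, ∑ b,
    MvPolynomial.C (h ij.1 a * (h⁻¹ : GL (Fin n) ℂ) b ij.2) * MvPolynomial.X (a, b)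

lemma mul_mul_apply (A B C : Matrix (Fin n) (Fin n) ℂ) (i j : Fin n) :
    (A * B * C) i j = ∑ a, ∑ b, A i a * C b j * B a b := by
  simp only [Matrix.mul_apply, Finset.sum_mul]
  rw [Finset.sum_comm]
  exact Finset.sum_congr rfl fun a _ => Finset.sum_congr rfl fun b _ => by ring

lemma evalAt_conjPoly (h x : GL (Fin n) ℂ) (p : MvPolynomial (Fin n × Fin n) ℂ) :
    evalAt x (conjPoly h p) = evalAt (h * x * h⁻¹) p := by
  unfold conjPoly evalAt
  rw [MvPolynomial.aeval_bind₁]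
  congr 2
  funext ij
  rw [Units.val_mul, Units.val_mul, mul_mul_apply]
  simp only [map_sum, map_mul, MvPolynomial.aeval_X, MvPolynomial.aeval_C,
    Algebra.algebraMap_self, RingHom.id_apply]

/-- The differential of conjugation at the identity is the adjoint action; the Leibniz rule reduces
this to the coordinate functions. -/
lemma diffOne_conjPoly (h : GL (Fin n) ℂ) (p : MvPolynomial (Fin n × Fin n) ℂ)
    (X : Matrix (Fin n) (Fin n) ℂ) :
    diffOne (conjPoly h p) X = diffOne p ((h : Matrix (Fin n) (Fin n) ℂ) * X *
      ((h⁻¹ : GL (Fin n) ℂ) : Matrix (Fin n) (Fin n) ℂ)) := by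
  induction p using MvPolynomial.induction_on with
  | C c =>
    rw [← MvPolynomial.algebraMap_eq, AlgHom.commutes, MvPolynomial.algebraMap_eq, diffOne_C,
      diffOne_C]
  | add p q hp hq => simp only [map_add, LinearMap.add_apply, hp, hq]
  | mul_X p ij hp =>
    rw [map_mul, diffOne_mul, diffOne_mul, hp, evalAt_conjPoly, evalAt_conjPoly, mul_one,
      mul_inv_cancel, diffOne_X]
    have : diffOne (conjPoly h (MvPolynomial.X ij)) X =
        ((h : Matrix (Fin n) (Fin n) ℂ) * X *
          ((h⁻¹ : GL (Fin n) ℂ) : Matrix (Fin n) (Fin n) ℂ)) ij.1 ij.2 := by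
      rw [conjPoly, MvPolynomial.bind₁_X_right, mul_mul_apply]
      simp only [map_sum, LinearMap.sum_apply, diffOne_mul, diffOne_C, mul_zero, zero_add, evalAt_C,
        diffOne_X, Algebra.algebraMap_self, RingHom.id_apply]
    rw [this]

end Tangent

/-! ### Trivial adjoint action implies centrality -/

section Central

variable {n : ℕ} {G : Subgroup (GL (Fin n) ℂ)}

lemma conjPoly_sub_mem_vanishing {h : GL (Fin n) ℂ} (hG : h ∈ G)
    {p : MvPolynomial (Fin n × Fin n) ℂ} (hp : p ∈ vanishing G) :
    conjPoly h p - p ∈ vanishing G := by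
  refine sub_mem (mem_vanishing.2 fun x hx => ?_) hp
  rw [evalAt_conjPoly]
  exact mem_vanishing.1 hp _ (G.mul_mem (G.mul_mem hG hx) (G.inv_mem hG))

lemma conjPoly_mem_idealOne (h : GL (Fin n) ℂ) {p : MvPolynomial (Fin n × Fin n) ℂ}
    (hp : p ∈ idealOne n) : conjPoly h p ∈ idealOne n := by
  rw [mem_idealOne, evalAt_conjPoly, mul_one, mul_inv_cancel]
  exact hp

/-- Conjugation by an element acting trivially on the Lie algebra acts trivially on the graded
ring of `G` at the identity. -/
lemma conjPoly_sub_mem {h : GL (Fin n) ℂ} (hG : h ∈ G)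
    (hX : ∀ X ∈ lieAlgebra G, (h : Matrix (Fin n) (Fin n) ℂ) * X *
      ((h⁻¹ : GL (Fin n) ℂ) : Matrix (Fin n) (Fin n) ℂ) = X) (k : ℕ)
    {p : MvPolynomial (Fin n × Fin n) ℂ} (hp : p ∈ idealOne n ^ k ⊔ vanishing G) :
    conjPoly h p - p ∈ idealOne n ^ (k + 1) ⊔ vanishing G := by
  have hlin : ∀ p ∈ idealOne n, conjPoly h p - p ∈ idealOne n ^ 2 ⊔ vanishing G := by
    intro p hp
    refine mem_sq_sup_vanishing ?_ fun X hXG => ?_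
    · exact sub_mem (conjPoly_mem_idealOne h hp) hp
    · rw [map_sub, LinearMap.sub_apply, diffOne_conjPoly, hX X hXG, sub_self]
  suffices hpow : ∀ p ∈ idealOne n ^ k,
      conjPoly h p - p ∈ idealOne n ^ (k + 1) ⊔ vanishing G by
    obtain ⟨a, ha, b, hb, rfl⟩ := Submodule.mem_sup.1 hp
    have := add_mem (hpow a ha) (Ideal.mem_sup_right (S := idealOne n ^ (k + 1))
      (conjPoly_sub_mem_vanishing hG hb))
    convert this using 1
    rw [map_add]
    ring
  clear hp
  induction k with
  | zero =>
    intro p _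
    refine Ideal.mem_sup_left ?_
    rw [zero_add, pow_one, mem_idealOne, evalAt_sub, evalAt_conjPoly, mul_one, mul_inv_cancel,
      sub_self]
  | succ k ih =>
    intro p hp
    rw [pow_succ] at hp
    refine Submodule.mul_induction_on hp (fun a ha b hb => ?_) (fun a b ha hb => ?_)
    -- Writing `φ` for conjugation, `φ(ab) - ab = (φ a - a) φ b + a (φ b - b)`, and each term gains
    -- one power.
    · have h1 : (conjPoly h a - a) * conjPoly h b ∈ idealOne n ^ (k + 1 + 1) ⊔ vanishing G := by
        have := Ideal.mul_mem_mul (ih a ha) (conjPoly_mem_idealOne h hb)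
        rw [Ideal.sup_mul, ← pow_succ] at this
        have hle : idealOne n ^ (k + 1 + 1) ⊔ vanishing G * idealOne n ≤
            idealOne n ^ (k + 1 + 1) ⊔ vanishing G := sup_le_sup le_rfl Ideal.mul_le_left
        exact hle this
      have h2 : a * (conjPoly h b - b) ∈ idealOne n ^ (k + 1 + 1) ⊔ vanishing G := by
        have := Ideal.mul_mem_mul ha (hlin b hb)
        rw [Ideal.mul_sup, ← pow_add] at this
        have hle : idealOne n ^ (k + 2) ⊔ idealOne n ^ k * vanishing G ≤
            idealOne n ^ (k + 2) ⊔ vanishing G := sup_le_sup le_rfl Ideal.mul_le_right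
        exact hle this
      convert add_mem h1 h2 using 1
      rw [map_mul]
      ring
    · convert add_mem ha hb using 1
      rw [map_add]
      ring

/-- Eigenfunctions of conjugation with a nontrivial eigenvalue vanish near the identity. -/
lemma exists_mul_mem_vanishing {h : GL (Fin n) ℂ} (hG : h ∈ G)
    (hX : ∀ X ∈ lieAlgebra G, (h : Matrix (Fin n) (Fin n) ℂ) * X *
      ((h⁻¹ : GL (Fin n) ℂ) : Matrix (Fin n) (Fin n) ℂ) = X)
    {p : MvPolynomial (Fin n × Fin n) ℂ} {c : ℂ} (hc : c ≠ 1)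
    (hp : conjPoly h p - MvPolynomial.C c * p ∈ vanishing G) :
    ∃ b, evalAt 1 b = 1 ∧ b * p ∈ vanishing G := by
  -- Conjugation fixes `p` modulo the next power, yet multiplies it by `c` modulo the ideal of `G`.
  -- Since `c - 1` is invertible, `p` climbs through all powers.
  have hk : ∀ k, p ∈ idealOne n ^ k ⊔ vanishing G := by
    intro k
    induction k with
    | zero => simp
    | succ k ih =>
      have h1 := sub_mem (conjPoly_sub_mem hG hX k ih)
        (Ideal.mem_sup_right (S := idealOne n ^ (k + 1)) hp)
      have h2 := Ideal.mul_mem_left _ (MvPolynomial.C (c - 1)⁻¹) h1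
      convert h2 using 1
      rw [show conjPoly h p - p - (conjPoly h p - MvPolynomial.C c * p) =
        MvPolynomial.C (c - 1) * p by rw [map_sub, map_one]; ring, ← mul_assoc, ← map_mul,
        inv_mul_cancel₀ (sub_ne_zero.2 hc), map_one, one_mul]
  have hmem : (Ideal.Quotient.mk (vanishing G) p) ∈
      (⨅ i, idealOne n ^ i • ⊤ : Submodule (MvPolynomial (Fin n × Fin n) ℂ)
        (MvPolynomial (Fin n × Fin n) ℂ ⧸ vanishing G)) := by
    refine Submodule.mem_iInf _ |>.2 fun k => ?_
    obtain ⟨a, ha, b, hb, hab⟩ := Submodule.mem_sup.1 (hk k)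
    have : Ideal.Quotient.mk (vanishing G) p = a • Ideal.Quotient.mk (vanishing G) 1 := by
      rw [← hab, map_add, Ideal.Quotient.eq_zero_iff_mem.2 hb, add_zero]
      exact congrArg (Ideal.Quotient.mk (vanishing G)) (mul_one a).symm
    rw [this]
    exact Submodule.smul_mem_smul ha Submodule.mem_top
  -- Krull's intersection theorem: some `1 - r`, with `r` in the maximal ideal of the identity,
  -- kills `p` on `G`.
  obtain ⟨r, hr⟩ := (Ideal.mem_iInf_smul_pow_eq_bot_iff _ _).1 hmem
  refine ⟨1 - r, ?_, ?_⟩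
  · rw [evalAt_sub, evalAt_one, mem_idealOne.1 r.2, sub_zero]
  · rw [← Ideal.Quotient.eq_zero_iff_mem, sub_mul, one_mul, map_sub, sub_eq_zero]
    exact hr.symm

/-- In a connected group, a diagonalizable element acting trivially on the Lie algebra is
central. -/
lemma commute_of_lieAlgebra (hconn : IsZariskiConnected (G : Set (GL (Fin n) ℂ)))
    (g : GL (Fin n) ℂ) (u : Fin n → ℂˣ) (hG : diagHom g u ∈ G)
    (hX : ∀ X ∈ lieAlgebra G, (diagHom g u : Matrix (Fin n) (Fin n) ℂ) * X *
      (((diagHom g u)⁻¹ : GL (Fin n) ℂ) : Matrix (Fin n) (Fin n) ℂ) = X)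
    {x : GL (Fin n) ℂ} (hx : x ∈ G) : diagHom g u * x = x * diagHom g u := by
  classical
  have hgg : g * diagHom g u * g⁻¹ = diagHom 1 u := by
    apply Units.ext
    rw [conj_diagHom, coe_diagHom]
    simp
  have hval : ∀ (y : GL (Fin n) ℂ) (ab : Fin n × Fin n),
      evalAt y (conjPoly g (MvPolynomial.X ab)) = (g * y * g⁻¹ : GL (Fin n) ℂ) ab.1 ab.2 :=
    fun y ab => by rw [evalAt_conjPoly, evalAt_X]
  have heig : ∀ ab : Fin n × Fin n, conjPoly (diagHom g u) (conjPoly g (MvPolynomial.X ab)) -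
      MvPolynomial.C ((u ab.1 : ℂ) * (u ab.2 : ℂ)⁻¹) * conjPoly g (MvPolynomial.X ab) ∈
        vanishing G := fun ab => by
    rw [mem_vanishing]
    intro y _
    rw [evalAt_sub, evalAt_mul, evalAt_C, evalAt_conjPoly, hval, hval]
    have : g * (diagHom g u * y * (diagHom g u)⁻¹) * g⁻¹ =
        diagHom 1 u * (g * y * g⁻¹) * diagHom 1 u⁻¹ := by
      rw [map_inv, ← hgg]
      group
    rw [this, Units.val_mul, Units.val_mul, coe_diagHom, coe_diagHom]
    simp only [inv_one, Units.val_one, Matrix.one_mul, Matrix.mul_one, Matrix.mul_diagonal,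
      Matrix.diagonal_mul, Algebra.algebraMap_self, RingHom.id_apply, Pi.inv_apply,
      Units.val_inv_eq_inv_val]
    ring
  have hb : ∀ ab : Fin n × Fin n, ∃ b : MvPolynomial (Fin n × Fin n) ℂ, evalAt 1 b = 1 ∧
      (u ab.1 ≠ u ab.2 → b * conjPoly g (MvPolynomial.X ab) ∈ vanishing G) := fun ab => by
    by_cases h : u ab.1 = u ab.2
    · exact ⟨1, evalAt_one _, fun h' => absurd h h'⟩
    · have hc : (u ab.1 : ℂ) * (u ab.2 : ℂ)⁻¹ ≠ 1 := by
        rw [Ne, mul_inv_eq_one₀ (Units.ne_zero _)]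
        exact fun h' => h (Units.ext h')
      obtain ⟨b, hb1, hb2⟩ := exists_mul_mem_vanishing hG hX hc (heig ab)
      exact ⟨b, hb1, fun _ => hb2⟩
  choose b hb1 hb2 using hb
  -- Where `B` does not vanish on `G`, all entries linking distinct eigenvalues of `diagHom g u`
  -- vanish, which means commuting with it. As `B` is one at the identity, the centralizer contains
  -- a neighbourhood of the identity in `G`.
  set B : MvPolynomial (Fin n × Fin n) ℂ := ∏ ab, b ab with hB
  have hB1 : evalAt 1 B = 1 := by
    rw [hB, evalAt_prod]
    exact Finset.prod_eq_one fun ab _ => hb1 ab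
  have hcoord : ∀ y : GL (Fin n) ℂ, diagHom g u * y = y * diagHom g u ↔
      ∀ ab : Fin n × Fin n, u ab.1 ≠ u ab.2 →
        evalAt y (conjPoly g (MvPolynomial.X ab)) = 0 := fun y => by
    have h1 : diagHom g u * y = y * diagHom g u ↔
        diagHom 1 u * (g * y * g⁻¹) = (g * y * g⁻¹) * diagHom 1 u := by
      rw [← hgg]
      constructor
      · intro h
        calc _ = g * (diagHom g u * y) * g⁻¹ := by group
          _ = _ := by rw [h]; group
      · intro h
        calc diagHom g u * y = g⁻¹ * (g * diagHom g u * g⁻¹ * (g * y * g⁻¹)) * g := by group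
          _ = _ := by rw [h]; group
    rw [h1, Units.ext_iff, Units.val_mul, Units.val_mul (g * y * g⁻¹), coe_diagHom]
    simp only [inv_one, Units.val_one, Matrix.one_mul, Matrix.mul_one, ← Matrix.ext_iff,
      Matrix.mul_diagonal, Matrix.diagonal_mul, hval, Prod.forall]
    refine forall₂_congr fun i j => ?_
    rw [mul_comm, mul_eq_mul_left_iff, ← Units.ext_iff]
    tauto
  have hnear : ∀ y ∈ G, evalAt y B ≠ 0 → diagHom g u * y = y * diagHom g u := by
    intro y hy hyB
    rw [hcoord]
    intro ab hab
    have := mem_vanishing.1 (hb2 ab hab) y hy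
    rw [evalAt_mul] at this
    refine (mul_eq_zero.1 this).resolve_left fun h0 => hyB ?_
    rw [hB, evalAt_prod]
    exact Finset.prod_eq_zero (Finset.mem_univ ab) h0
  have htrans : ∀ c : GL (Fin n) ℂ, ∃ q : MvPolynomial (Fin n × Fin n) ℂ,
      ∀ y, evalAt y q = evalAt (c * y) B := fun c => by
    refine ⟨MvPolynomial.bind₁ (fun ij : Fin n × Fin n =>
      ∑ a, MvPolynomial.C (c ij.1 a) * MvPolynomial.X (a, ij.2)) B, fun y => ?_⟩
    unfold evalAt
    rw [MvPolynomial.aeval_bind₁]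
    congr 2
    funext ij
    simp only [Units.val_mul, Matrix.mul_apply, map_sum, map_mul, MvPolynomial.aeval_X,
      MvPolynomial.aeval_C, Algebra.algebraMap_self, RingHom.id_apply]
  choose q hq using htrans
  have h1C : ∀ c ∈ G, diagHom g u * c = c * diagHom g u →
      diagHom g u * c⁻¹ = c⁻¹ * diagHom g u := fun c _ h => by
    have : Commute (diagHom g u) c := h
    exact this.inv_right
  -- The centralizer is closed, and its complement in `G` is closed too: it is the set where all
  -- translates of `B` by centralizing elements vanish. The identity lies in the centralizer, so
  -- connectedness gives everything.
  have key := hconn {y | diagHom g u * y = y * diagHom g u}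
    {y | ∀ c ∈ G, diagHom g u * c = c * diagHom g u → evalAt (c⁻¹ * y) B = 0}
    ⟨{p | ∃ ab : Fin n × Fin n, u ab.1 ≠ u ab.2 ∧ p = conjPoly g (MvPolynomial.X ab)}, by
      ext y
      simp only [Set.mem_ofPred_eq, hcoord]
      constructor
      · rintro h p ⟨ab, hab, rfl⟩
        exact h ab hab
      · exact fun h ab hab => h _ ⟨ab, hab, rfl⟩⟩
    ⟨{p | ∃ c ∈ G, diagHom g u * c = c * diagHom g u ∧ p = q c⁻¹}, by
      ext y
      simp only [Set.mem_ofPred_eq]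
      constructor
      · rintro h p ⟨c, hc, hcu, rfl⟩
        rw [hq]
        exact h c hc hcu
      · exact fun h c hc hcu => by rw [← hq]; exact h _ ⟨c, hc, hcu, rfl⟩⟩
    (by
      intro y hy
      by_cases hyu : diagHom g u * y = y * diagHom g u
      · exact Or.inl hyu
      · refine Or.inr fun c hc hcu => ?_
        by_contra hne
        apply hyu
        have h1 : Commute (diagHom g u) (c⁻¹ * y) :=
          hnear _ (G.mul_mem (G.inv_mem hc) hy) hne
        have h2 : Commute (diagHom g u) c := hcu
        have := h2.mul_right h1
        rwa [mul_inv_cancel_left] at this)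
    (by
      rw [Set.eq_empty_iff_forall_notMem]
      rintro y ⟨⟨hyG, hyu⟩, hy⟩
      have := hy y hyG hyu
      rw [inv_mul_cancel, hB1] at this
      exact one_ne_zero this)
  rcases key with h | h
  · exact h hx
  · have := h G.one_mem 1 G.one_mem (by rw [mul_one, one_mul])
    rw [inv_one, one_mul, hB1] at this
    exact absurd this one_ne_zero

end Central

variable {n : ℕ}

/-! ### Characters form a group; coordinates on a diagonalizable group -/

section CharacterGroup

lemma exists_evalAt_det : ∃ D : MvPolynomial (Fin n × Fin n) ℂ, ∀ t : GL (Fin n) ℂ,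
    (t : Matrix (Fin n) (Fin n) ℂ).det = evalAt t D := by
  refine ⟨(Matrix.of fun i j => MvPolynomial.X (i, j)).det, fun t => ?_⟩
  rw [evalAt, AlgHom.map_det]
  congr 1
  ext i j
  simp

/-- Entries of the inverse are entries of the adjugate over the determinant. This is what makes the
inverse of a character regular. -/
lemma exists_evalAt_inv (p : MvPolynomial (Fin n × Fin n) ℂ) :
    ∃ (q : MvPolynomial (Fin n × Fin n) ℂ) (N : ℕ), ∀ t : GL (Fin n) ℂ,
      evalAt t⁻¹ p * (t : Matrix (Fin n) (Fin n) ℂ).det ^ N = evalAt t q := by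
  have hadj : ∀ ij : Fin n × Fin n, ∃ q : MvPolynomial (Fin n × Fin n) ℂ, ∀ t : GL (Fin n) ℂ,
      (t⁻¹ : GL (Fin n) ℂ) ij.1 ij.2 * (t : Matrix (Fin n) (Fin n) ℂ).det = evalAt t q := by
    intro ij
    refine ⟨(Matrix.of fun i j => (MvPolynomial.X (i, j) :
        MvPolynomial (Fin n × Fin n) ℂ)).adjugate ij.1 ij.2, fun t => ?_⟩
    have h1 : evalAt t ((Matrix.of fun i j => (MvPolynomial.X (i, j) :
        MvPolynomial (Fin n × Fin n) ℂ)).adjugate ij.1 ij.2) =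
        (t : Matrix (Fin n) (Fin n) ℂ).adjugate ij.1 ij.2 := by
      have h2 := AlgHom.map_adjugate (MvPolynomial.aeval (R := ℂ) (fun ij : Fin n × Fin n =>
        (t : Matrix (Fin n) (Fin n) ℂ) ij.1 ij.2))
        (Matrix.of fun i j => (MvPolynomial.X (i, j) : MvPolynomial (Fin n × Fin n) ℂ))
      have h3 : (MvPolynomial.aeval (R := ℂ) (fun ij : Fin n × Fin n =>
          (t : Matrix (Fin n) (Fin n) ℂ) ij.1 ij.2)).mapMatrix
          (Matrix.of fun i j => (MvPolynomial.X (i, j) : MvPolynomial (Fin n × Fin n) ℂ)) =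
          (t : Matrix (Fin n) (Fin n) ℂ) := by
        ext i j
        simp
      rw [h3] at h2
      rw [← h2]
      rfl
    have h4 : (t : Matrix (Fin n) (Fin n) ℂ).adjugate =
        (t : Matrix (Fin n) (Fin n) ℂ).det • ((t⁻¹ : GL (Fin n) ℂ) : Matrix (Fin n) (Fin n) ℂ) := by
      have h5 : (t : Matrix (Fin n) (Fin n) ℂ) *
          ((t⁻¹ : GL (Fin n) ℂ) : Matrix (Fin n) (Fin n) ℂ) = 1 := by
        rw [← Units.val_mul, mul_inv_cancel, Units.val_one]
      calc _ = (t : Matrix (Fin n) (Fin n) ℂ).adjugate * ((t : Matrix (Fin n) (Fin n) ℂ) *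
          ((t⁻¹ : GL (Fin n) ℂ) : Matrix (Fin n) (Fin n) ℂ)) := by rw [h5, Matrix.mul_one]
        _ = _ := by rw [← Matrix.mul_assoc, Matrix.adjugate_mul, Matrix.smul_mul, Matrix.one_mul]
    rw [h1, h4, Matrix.smul_apply, smul_eq_mul, mul_comm]
  obtain ⟨D, hD⟩ := exists_evalAt_det (n := n)
  induction p using MvPolynomial.induction_on with
  | C c =>
    refine ⟨MvPolynomial.C c, 0, fun t => ?_⟩
    rw [evalAt_C, evalAt_C, pow_zero, mul_one]
  | add p₁ p₂ h₁ h₂ =>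
    obtain ⟨q₁, N₁, h₁⟩ := h₁
    obtain ⟨q₂, N₂, h₂⟩ := h₂
    refine ⟨q₁ * D ^ N₂ + q₂ * D ^ N₁, N₁ + N₂, fun t => ?_⟩
    rw [evalAt_add, evalAt_add, evalAt_mul, evalAt_mul, evalAt_pow, evalAt_pow, ← hD, ← h₁, ← h₂]
    ring
  | mul_X p ij h =>
    obtain ⟨q, N, h⟩ := h
    obtain ⟨q', h'⟩ := hadj ij
    refine ⟨q * q', N + 1, fun t => ?_⟩
    rw [evalAt_mul, evalAt_mul, evalAt_X, ← h', ← h]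
    ring

/-- The character group of `T`. -/
def characterGroup (T : Subgroup (GL (Fin n) ℂ)) : Subgroup (T →* ℂˣ) where
  carrier := characters T
  one_mem' := ⟨1, 0, fun t => by simp [evalAt_one]⟩
  mul_mem' := by
    rintro χ ψ ⟨p, k, hp⟩ ⟨q, l, hq⟩
    refine ⟨p * q, k + l, fun t => ?_⟩
    rw [evalAt_mul, ← hp, ← hq, MonoidHom.mul_apply, Units.val_mul]
    ring
  inv_mem' := by
    rintro χ ⟨p, k, hp⟩
    obtain ⟨q, N, hq⟩ := exists_evalAt_inv p
    obtain ⟨D, hD⟩ := exists_evalAt_det (n := n)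
    refine ⟨q * D ^ k, N, fun t => ?_⟩
    rw [evalAt_mul, evalAt_pow, ← hD, ← hq]
    have h := hp t⁻¹
    rw [map_inv] at h
    rw [Subgroup.coe_inv] at h
    rw [← h, MonoidHom.inv_apply]
    have hd : ((((t : GL (Fin n) ℂ)⁻¹ : GL (Fin n) ℂ) : Matrix (Fin n) (Fin n) ℂ)).det *
        ((t : GL (Fin n) ℂ) : Matrix (Fin n) (Fin n) ℂ).det = 1 := by
      rw [← Matrix.det_mul, ← Units.val_mul, inv_mul_cancel, Units.val_one, Matrix.det_one]
    calc _ = ((χ t)⁻¹ : ℂˣ) * ((((((t : GL (Fin n) ℂ)⁻¹ : GL (Fin n) ℂ) :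
          Matrix (Fin n) (Fin n) ℂ)).det * ((t : GL (Fin n) ℂ) : Matrix (Fin n) (Fin n) ℂ).det) ^ k)
          * ((t : GL (Fin n) ℂ) : Matrix (Fin n) (Fin n) ℂ).det ^ N := by rw [hd]; simp
      _ = _ := by ring

/-- Coordinates on a diagonalizable group. -/
lemma exists_coords {T : Subgroup (GL (Fin n) ℂ)} {g : GL (Fin n) ℂ}
    (hg : ∀ t ∈ T, ((g * t * g⁻¹ : GL (Fin n) ℂ) : Matrix (Fin n) (Fin n) ℂ).IsDiag) :
    ∃ τ : Fin n → T →* ℂˣ, (∀ t : T, (t : GL (Fin n) ℂ) = diagHom g fun a => τ a t) ∧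
      ∀ a, τ a ∈ characters T := by
  choose u hu using fun t : T => exists_diagHom_of_isDiag g t (hg t t.2)
  let τ : T →* (Fin n → ℂˣ) :=
    { toFun := u
      map_one' := diagHom_injective g (by rw [← hu, map_one, Subgroup.coe_one])
      map_mul' := fun s t => diagHom_injective g (by
        rw [← hu, map_mul, ← hu, ← hu, Subgroup.coe_mul]) }
  refine ⟨fun a => (Pi.evalMonoidHom _ a).comp τ, fun t => hu t, fun a => ?_⟩
  refine ⟨conjPoly g (MvPolynomial.X (a, a)), 0, fun t => ?_⟩
  rw [evalAt_conjPoly, evalAt_X, hu t, conj_diagHom, pow_zero, mul_one, Matrix.diagonal_apply_eq]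
  rfl

end CharacterGroup

/-! ### Weights of a torus on the Lie algebra -/

section Weights

/-- The coordinates of a matrix in the basis given by `g`. -/
lemma conj_conj_apply (g : GL (Fin n) ℂ) (u : Fin n → ℂˣ) (X : Matrix (Fin n) (Fin n) ℂ)
    (a b : Fin n) :
    ((g : Matrix (Fin n) (Fin n) ℂ) * ((diagHom g u : Matrix (Fin n) (Fin n) ℂ) * X *
      (((diagHom g u)⁻¹ : GL (Fin n) ℂ) : Matrix (Fin n) (Fin n) ℂ)) *
        ((g⁻¹ : GL (Fin n) ℂ) : Matrix (Fin n) (Fin n) ℂ)) a b =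
    ((u a / u b : ℂˣ) : ℂ) * ((g : Matrix (Fin n) (Fin n) ℂ) * X *
      ((g⁻¹ : GL (Fin n) ℂ) : Matrix (Fin n) (Fin n) ℂ)) a b := by
  have h : (g : Matrix (Fin n) (Fin n) ℂ) *
      ((g⁻¹ : GL (Fin n) ℂ) : Matrix (Fin n) (Fin n) ℂ) = 1 := by
    rw [← Units.val_mul, mul_inv_cancel, Units.val_one]
  rw [← map_inv, coe_diagHom, coe_diagHom]
  have : (g : Matrix (Fin n) (Fin n) ℂ) * ((((g⁻¹ : GL (Fin n) ℂ) : Matrix (Fin n) (Fin n) ℂ) *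
      Matrix.diagonal (fun a => (u a : ℂ)) * (g : Matrix (Fin n) (Fin n) ℂ)) * X *
      (((g⁻¹ : GL (Fin n) ℂ) : Matrix (Fin n) (Fin n) ℂ) *
      Matrix.diagonal (fun a => ((u⁻¹) a : ℂ)) * (g : Matrix (Fin n) (Fin n) ℂ))) *
        ((g⁻¹ : GL (Fin n) ℂ) : Matrix (Fin n) (Fin n) ℂ) =
      ((g : Matrix (Fin n) (Fin n) ℂ) * ((g⁻¹ : GL (Fin n) ℂ) : Matrix (Fin n) (Fin n) ℂ)) *
      (Matrix.diagonal (fun a => (u a : ℂ)) * ((g : Matrix (Fin n) (Fin n) ℂ) * X *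
        ((g⁻¹ : GL (Fin n) ℂ) : Matrix (Fin n) (Fin n) ℂ)) *
          Matrix.diagonal (fun a => ((u⁻¹) a : ℂ))) *
      ((g : Matrix (Fin n) (Fin n) ℂ) * ((g⁻¹ : GL (Fin n) ℂ) : Matrix (Fin n) (Fin n) ℂ)) := by
    simp only [Matrix.mul_assoc]
  rw [this, h, Matrix.one_mul, Matrix.mul_one, Matrix.mul_diagonal, Matrix.diagonal_mul,
    Units.val_div_eq_div_val, Pi.inv_apply, Units.val_inv_eq_inv_val]
  ring

lemma conj_injective (g : GL (Fin n) ℂ) {X Y : Matrix (Fin n) (Fin n) ℂ}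
    (h : (g : Matrix (Fin n) (Fin n) ℂ) * X * ((g⁻¹ : GL (Fin n) ℂ) : Matrix (Fin n) (Fin n) ℂ) =
      (g : Matrix (Fin n) (Fin n) ℂ) * Y * ((g⁻¹ : GL (Fin n) ℂ) : Matrix (Fin n) (Fin n) ℂ)) :
    X = Y := by
  have h' : ((g⁻¹ : GL (Fin n) ℂ) : Matrix (Fin n) (Fin n) ℂ) *
      (g : Matrix (Fin n) (Fin n) ℂ) = 1 := by
    rw [← Units.val_mul, inv_mul_cancel, Units.val_one]
  have key : ∀ Z : Matrix (Fin n) (Fin n) ℂ, Z =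
      ((g⁻¹ : GL (Fin n) ℂ) : Matrix (Fin n) (Fin n) ℂ) * ((g : Matrix (Fin n) (Fin n) ℂ) * Z *
        ((g⁻¹ : GL (Fin n) ℂ) : Matrix (Fin n) (Fin n) ℂ)) * (g : Matrix (Fin n) (Fin n) ℂ) := by
    intro Z
    rw [Matrix.mul_assoc, Matrix.mul_assoc, h', Matrix.mul_one, ← Matrix.mul_assoc, h',
      Matrix.one_mul]
  rw [key X, h, ← key Y]

/-- The eigenvalues of conjugation by a diagonal matrix. -/
lemma exists_eq_div (g : GL (Fin n) ℂ) {X : Matrix (Fin n) (Fin n) ℂ} (hX : X ≠ 0) :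
    ∃ a b, ∀ (u : Fin n → ℂˣ) (c : ℂ), (diagHom g u : Matrix (Fin n) (Fin n) ℂ) * X *
      (((diagHom g u)⁻¹ : GL (Fin n) ℂ) : Matrix (Fin n) (Fin n) ℂ) = c • X →
      c = (u a / u b : ℂˣ) := by
  have : (g : Matrix (Fin n) (Fin n) ℂ) * X *
      ((g⁻¹ : GL (Fin n) ℂ) : Matrix (Fin n) (Fin n) ℂ) ≠ 0 := fun h =>
    hX (conj_injective g (by rw [h, Matrix.mul_zero, Matrix.zero_mul]))
  obtain ⟨a, b, hab⟩ : ∃ a b, ((g : Matrix (Fin n) (Fin n) ℂ) * X *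
      ((g⁻¹ : GL (Fin n) ℂ) : Matrix (Fin n) (Fin n) ℂ)) a b ≠ 0 := by
    by_contra! h
    exact this (Matrix.ext h)
  refine ⟨a, b, fun u c h => ?_⟩
  have := conj_conj_apply g u X a b
  rw [h, Matrix.mul_smul, Matrix.smul_mul, Matrix.smul_apply, smul_eq_mul] at this
  exact mul_right_cancel₀ hab this

variable {G T : Subgroup (GL (Fin n) ℂ)}

/-- Quotients of coordinates occurring in the Lie algebra are roots. -/
lemma div_mem_roots (hTG : T ≤ G) {g : GL (Fin n) ℂ} {τ : Fin n → T →* ℂˣ}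
    (hτ : ∀ t : T, (t : GL (Fin n) ℂ) = diagHom g fun a => τ a t)
    (hchar : ∀ a, τ a ∈ characters T) {X : Matrix (Fin n) (Fin n) ℂ} (hX : X ∈ lieAlgebra G)
    {a b : Fin n} (hab : ((g : Matrix (Fin n) (Fin n) ℂ) * X *
      ((g⁻¹ : GL (Fin n) ℂ) : Matrix (Fin n) (Fin n) ℂ)) a b ≠ 0) (h1 : τ a / τ b ≠ 1) :
    τ a / τ b ∈ roots G T := by
  classical
  have hg : (g : Matrix (Fin n) (Fin n) ℂ) *
      ((g⁻¹ : GL (Fin n) ℂ) : Matrix (Fin n) (Fin n) ℂ) = 1 := by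
    rw [← Units.val_mul, mul_inv_cancel, Units.val_one]
  let E : Fin n × Fin n → Matrix (Fin n) (Fin n) ℂ := fun cd =>
    ((g⁻¹ : GL (Fin n) ℂ) : Matrix (Fin n) (Fin n) ℂ) * Matrix.single cd.1 cd.2 1 *
      (g : Matrix (Fin n) (Fin n) ℂ)
  let x : Fin n × Fin n → ℂ := fun cd => ((g : Matrix (Fin n) (Fin n) ℂ) * X *
    ((g⁻¹ : GL (Fin n) ℂ) : Matrix (Fin n) (Fin n) ℂ)) cd.1 cd.2
  have hgE : ∀ cd, (g : Matrix (Fin n) (Fin n) ℂ) * E cd *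
      ((g⁻¹ : GL (Fin n) ℂ) : Matrix (Fin n) (Fin n) ℂ) = Matrix.single cd.1 cd.2 1 := by
    intro cd
    simp only [E]
    rw [Matrix.mul_assoc, Matrix.mul_assoc, hg, Matrix.mul_one, ← Matrix.mul_assoc, hg,
      Matrix.one_mul]
  have hcoord : ∀ (s : Finset (Fin n × Fin n)) (y : Fin n × Fin n → ℂ) (c d : Fin n),
      ((g : Matrix (Fin n) (Fin n) ℂ) * (∑ cd ∈ s, y cd • E cd) *
        ((g⁻¹ : GL (Fin n) ℂ) : Matrix (Fin n) (Fin n) ℂ)) c d =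
      if (c, d) ∈ s then y (c, d) else 0 := by
    intro s y c d
    rw [Matrix.mul_sum, Matrix.sum_mul, Matrix.sum_apply]
    simp only [Matrix.mul_smul, Matrix.smul_mul, hgE, Matrix.smul_apply, smul_eq_mul]
    rw [← Finset.sum_ite_eq s (c, d) y]
    refine Finset.sum_congr rfl fun cd _ => ?_
    by_cases h : (c, d) = cd
    · subst h
      simp
    · rw [if_neg h, Matrix.single_apply_of_ne, mul_zero]
      rintro ⟨h1, h2⟩
      exact h (Prod.ext h1.symm h2.symm)
  have hconj : ∀ t : T, ((t : GL (Fin n) ℂ) : Matrix (Fin n) (Fin n) ℂ) * X *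
      (((t : GL (Fin n) ℂ)⁻¹ : GL (Fin n) ℂ) : Matrix (Fin n) (Fin n) ℂ) =
      ∑ cd : Fin n × Fin n, (((τ cd.1 / τ cd.2) t : ℂˣ) * x cd : ℂ) • E cd := by
    intro t
    refine conj_injective g (Matrix.ext fun c d => ?_)
    rw [hcoord, hτ t, conj_conj_apply, if_pos (Finset.mem_univ _)]
    rfl
  -- The component of `X` of weight `τ a / τ b`. It stays in the Lie algebra: for `p` in the ideal
  -- of `G`, the differential vanishes on every `t X t⁻¹`, which is a relation among characters of
  -- `T`, so the coefficient of each character vanishes.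
  let Y : Matrix (Fin n) (Fin n) ℂ := ∑ cd with τ cd.1 / τ cd.2 = τ a / τ b, x cd • E cd
  have hY : ∀ c d, ((g : Matrix (Fin n) (Fin n) ℂ) * Y *
      ((g⁻¹ : GL (Fin n) ℂ) : Matrix (Fin n) (Fin n) ℂ)) c d =
      if τ c / τ d = τ a / τ b then x (c, d) else 0 := fun c d => by
    rw [hcoord]
    simp
  refine ⟨(characterGroup T).div_mem (hchar a) (hchar b), h1, Y, ?_, ?_, fun t => ?_⟩
  · rw [mem_lieAlgebra]
    intro p hp
    have key := sum_filter_eq_zero_of_characters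
      (fun cd : Fin n × Fin n => (Units.coeHom ℂ).comp (τ cd.1 / τ cd.2))
      (fun cd => x cd * diffOne p (E cd)) (fun t : T => ?_)
      ((Units.coeHom ℂ).comp (τ a / τ b))
    · simp only [Y, map_sum, map_smul, smul_eq_mul]
      rw [← key]
      refine Finset.sum_congr (Finset.filter_congr fun cd _ => ?_) fun _ _ => rfl
      constructor
      · intro h
        rw [h]
      · intro h
        ext t
        exact DFunLike.congr_fun h t
    · have h2 : diffOne p (((t : GL (Fin n) ℂ) : Matrix (Fin n) (Fin n) ℂ) * X *
          (((t : GL (Fin n) ℂ)⁻¹ : GL (Fin n) ℂ) : Matrix (Fin n) (Fin n) ℂ)) = 0 := by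
        rw [← diffOne_conjPoly]
        refine mem_lieAlgebra.1 hX _ ?_
        have := add_mem (conjPoly_sub_mem_vanishing (hTG t.2) hp) hp
        rwa [sub_add_cancel] at this
      rw [hconj, map_sum] at h2
      rw [← h2]
      refine Finset.sum_congr rfl fun cd _ => ?_
      rw [map_smul, smul_eq_mul, MonoidHom.comp_apply, Units.coeHom_apply]
      ring
  · intro h0
    have := hY a b
    rw [h0, Matrix.mul_zero, Matrix.zero_mul, if_pos rfl] at this
    exact hab this.symm
  · refine conj_injective g (Matrix.ext fun c d => ?_)
    rw [Matrix.mul_smul, Matrix.smul_mul, Matrix.smul_apply, smul_eq_mul, hτ t, conj_conj_apply,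
      hY]
    split_ifs with h
    · rw [← h]
      rfl
    · rw [mul_zero, mul_zero]

/-- There are finitely many roots, and each of them is a quotient of coordinates. -/
lemma exists_eq_div_of_mem_roots {g : GL (Fin n) ℂ} {τ : Fin n → T →* ℂˣ}
    (hτ : ∀ t : T, (t : GL (Fin n) ℂ) = diagHom g fun a => τ a t) {α : T →* ℂˣ}
    (hα : α ∈ roots G T) : ∃ a b, α = τ a / τ b := by
  obtain ⟨-, -, X, -, hX0, hX⟩ := hα
  obtain ⟨a, b, hab⟩ := exists_eq_div g hX0
  refine ⟨a, b, MonoidHom.ext fun t => Units.ext ?_⟩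
  have h := hX t
  rw [hτ t] at h
  exact hab _ _ h

lemma finite_roots (hT : IsTorus T) : (roots G T).Finite := by
  obtain ⟨g, hg⟩ := hT.diagonalizable
  obtain ⟨τ, hτ, -⟩ := exists_coords hg
  refine (Set.finite_range fun ab : Fin n × Fin n => τ ab.1 / τ ab.2).subset fun α hα => ?_
  obtain ⟨a, b, rfl⟩ := exists_eq_div_of_mem_roots hτ hα
  exact ⟨(a, b), rfl⟩

end Weights

/-! ### The connected group generated by a positive diagonal element -/

section Polar

/-- The points satisfying all monomial equations satisfied by `w`. -/
def monomialClosure (w : Fin n → ℂˣ) : Subgroup (Fin n → ℂˣ) where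
  carrier := {y | ∀ e e' : Fin n →₀ ℕ, ∏ a, w a ^ e a = ∏ a, w a ^ e' a →
    ∏ a, y a ^ e a = ∏ a, y a ^ e' a}
  one_mem' := fun e e' _ => by simp
  mul_mem' := fun {x y} hx hy e e' h => by
    simp only [Pi.mul_apply, mul_pow, Finset.prod_mul_distrib]
    rw [hx e e' h, hy e e' h]
  inv_mem' := fun {x} hx e e' h => by
    simp only [Pi.inv_apply, inv_pow, Finset.prod_inv_distrib]
    rw [hx e e' h]

lemma self_mem_monomialClosure (w : Fin n → ℂˣ) : w ∈ monomialClosure w := fun _ _ h => h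

lemma apply_eq_of_mem_monomialClosure {w y : Fin n → ℂˣ} (hy : y ∈ monomialClosure w) {a b : Fin n}
    (h : w a = w b) : y a = y b := by
  classical
  have key : ∀ (z : Fin n → ℂˣ) (c : Fin n), ∏ d, z d ^ (Finsupp.single c 1 : Fin n →₀ ℕ) d = z c :=
    fun z c => by
      rw [Finset.prod_eq_single c]
      · simp
      · intro d _ hd
        simp [hd.symm]
      · simp
  have := hy (Finsupp.single a 1) (Finsupp.single b 1) (by rw [key, key, h])
  rwa [key, key] at this

/-- Two kinds of equations suffice: off-diagonal entries after conjugation by `g`, and the binomials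
satisfied by `w`. -/
lemma isZariskiClosed_map_monomialClosure (g : GL (Fin n) ℂ) (w : Fin n → ℂˣ) :
    IsZariskiClosed (((monomialClosure w).map (diagHom g) : Subgroup (GL (Fin n) ℂ)) :
      Set (GL (Fin n) ℂ)) := by
  have hval : ∀ (y : GL (Fin n) ℂ) (ab : Fin n × Fin n),
      evalAt y (conjPoly g (MvPolynomial.X ab)) = (g * y * g⁻¹ : GL (Fin n) ℂ) ab.1 ab.2 :=
    fun y ab => by rw [evalAt_conjPoly, evalAt_X]
  refine ⟨{p | ∃ a b, a ≠ b ∧ p = conjPoly g (MvPolynomial.X (a, b))} ∪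
    {p | ∃ e e' : Fin n →₀ ℕ, ∏ a, w a ^ e a = ∏ a, w a ^ e' a ∧
      p = ∏ a, conjPoly g (MvPolynomial.X (a, a)) ^ e a -
        ∏ a, conjPoly g (MvPolynomial.X (a, a)) ^ e' a}, ?_⟩
  have hmon : ∀ (y : Fin n → ℂˣ) (e e' : Fin n →₀ ℕ), evalAt (diagHom g y)
      (∏ a, conjPoly g (MvPolynomial.X (a, a)) ^ e a -
        ∏ a, conjPoly g (MvPolynomial.X (a, a)) ^ e' a) = 0 ↔
      ∏ a, y a ^ e a = ∏ a, y a ^ e' a := by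
    intro y e e'
    rw [evalAt_sub, evalAt_prod, evalAt_prod, sub_eq_zero, Units.ext_iff]
    simp only [evalAt_pow, hval, conj_diagHom, Matrix.diagonal_apply_eq, Units.coe_prod,
      Units.val_pow_eq_pow_val]
  ext x
  simp only [SetLike.mem_coe, Subgroup.mem_map, Set.mem_ofPred_eq]
  constructor
  · rintro ⟨y, hy, rfl⟩ p (⟨a, b, hab, rfl⟩ | ⟨e, e', h, rfl⟩)
    · rw [hval, conj_diagHom, Matrix.diagonal_apply_ne _ hab]
    · exact (hmon y e e').2 (hy e e' h)
  · intro h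
    obtain ⟨y, rfl⟩ := exists_diagHom_of_isDiag g x (fun a b hab => by
      have := h _ (Or.inl ⟨a, b, hab, rfl⟩)
      rwa [hval] at this)
    exact ⟨y, fun e e' hee => (hmon y e e').1 (h _ (Or.inr ⟨e, e', hee, rfl⟩)), rfl⟩

lemma continuous_evalAt_diagHom (g : GL (Fin n) ℂ) (p : MvPolynomial (Fin n × Fin n) ℂ)
    (y : ℝ → Fin n → ℂˣ) (hy : ∀ a, Continuous fun s => (y s a : ℂ)) :
    Continuous fun s => evalAt (diagHom g (y s)) p := by
  have : ∀ ij : Fin n × Fin n, Continuous fun s =>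
      (diagHom g (y s) : Matrix (Fin n) (Fin n) ℂ) ij.1 ij.2 := by
    intro ij
    simp only [coe_diagHom, Matrix.mul_apply]
    fun_prop
  simp only [evalAt, MvPolynomial.aeval_eq_eval]
  exact (MvPolynomial.continuous_eval p).comp (continuous_pi this)

/-- The real powers of a positive `w` form a continuous image of the line inside the closure, and a
Zariski-closed set containing them contains the natural powers of `w`, hence the whole closure.
Connectedness is thus inherited from `ℝ`. -/
lemma isZariskiConnected_map_monomialClosure (g : GL (Fin n) ℂ) (v : Fin n → ℝ) (w : Fin n → ℂˣ)
    (hw : ∀ a, (w a : ℂ) = Real.exp (v a)) :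
    IsZariskiConnected (((monomialClosure w).map (diagHom g) : Subgroup (GL (Fin n) ℂ)) :
      Set (GL (Fin n) ℂ)) := by
  let y : ℝ → Fin n → ℂˣ := fun s a =>
    Units.mk0 ((Real.exp (s * v a) : ℝ) : ℂ) (by exact_mod_cast (Real.exp_pos _).ne')
  have hyc : ∀ a, Continuous fun s => (y s a : ℂ) := fun a => by
    simp only [y, Units.val_mk0]
    fun_prop
  have hpow : ∀ k : ℕ, w ^ k = y k := fun k => by
    funext a
    apply Units.ext
    simp only [Pi.pow_apply, Units.val_pow_eq_pow_val, hw, y, Units.val_mk0]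
    rw [Real.exp_nat_mul, Complex.ofReal_pow]
  -- Positivity matters here: the real exponential is injective, so a monomial relation at `w` is a
  -- linear relation in `v`, which survives scaling by `s`.
  have hymem : ∀ s, y s ∈ monomialClosure w := by
    intro s e e' h
    have hprod : ∀ (s : ℝ) (e : Fin n →₀ ℕ), ((∏ a, y s a ^ e a : ℂˣ) : ℂ) =
        (Real.exp (s * ∑ a, e a * v a) : ℝ) := fun s e => by
      simp only [Units.coe_prod, Units.val_pow_eq_pow_val, y, Units.val_mk0]
      rw [Finset.mul_sum, Real.exp_sum, Complex.ofReal_prod]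
      refine Finset.prod_congr rfl fun a _ => ?_
      rw [← Complex.ofReal_pow, ← Real.exp_nat_mul]
      congr 2
      ring
    have hw1 : w = y 1 := by
      have := hpow 1
      rwa [pow_one, Nat.cast_one] at this
    rw [hw1] at h
    have h' := congrArg Units.val h
    rw [hprod, hprod, one_mul, one_mul, Complex.ofReal_inj, Real.exp_eq_exp] at h'
    apply Units.ext
    rw [hprod, hprod, h']
  have hclosed : ∀ A : Set (GL (Fin n) ℂ), IsZariskiClosed A →
      IsClosed {s : ℝ | diagHom g (y s) ∈ A} := by
    rintro A ⟨P, rfl⟩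
    have : {s : ℝ | diagHom g (y s) ∈ {x : GL (Fin n) ℂ | ∀ p ∈ P, evalAt x p = 0}} =
        ⋂ p ∈ P, {s : ℝ | evalAt (diagHom g (y s)) p = 0} := by
      ext s
      simp
    rw [this]
    exact isClosed_biInter fun p _ =>
      isClosed_eq (continuous_evalAt_diagHom g p y hyc) continuous_const
  have hsub : ∀ A : Set (GL (Fin n) ℂ), IsZariskiClosed A →
      (∀ s : ℝ, diagHom g (y s) ∈ A) →
      (((monomialClosure w).map (diagHom g) : Subgroup (GL (Fin n) ℂ)) :
        Set (GL (Fin n) ℂ)) ⊆ A := by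
    rintro A ⟨P, rfl⟩ h _ ⟨z, hz, rfl⟩ p hp
    refine evalAt_diagHom_eq_zero g p w z hz fun k => ?_
    rw [hpow]
    exact h k p hp
  intro A B hA hB hAB hdisj
  have hpre := isPreconnected_iff_subset_of_disjoint_closed.1
    (isPreconnected_univ (α := ℝ)) _ _ (hclosed A hA) (hclosed B hB)
    (fun s _ => hAB ⟨y s, hymem s, rfl⟩) (by
      rw [Set.eq_empty_iff_forall_notMem]
      rintro s ⟨-, hsA, hsB⟩
      have : diagHom g (y s) ∈ (∅ : Set (GL (Fin n) ℂ)) := by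
        rw [← hdisj]
        exact ⟨⟨⟨y s, hymem s, rfl⟩, hsA⟩, hsB⟩
      exact this)
  rcases hpre with h | h
  · exact Or.inl (hsub A hA fun s => h (Set.mem_univ s))
  · exact Or.inr (hsub B hB fun s => h (Set.mem_univ s))

end Polar

/-! ### Elements whose root values all lie on the unit circle -/

/-- In a semisimple group, an element of a torus all of whose root values have absolute value one
has all its eigenvalues of absolute value one. -/
lemma norm_eq_one_of_roots {G T : Subgroup (GL (Fin n) ℂ)} (hG : IsSemisimpleGroup G)
    (hTG : T ≤ G) {g : GL (Fin n) ℂ} {τ : Fin n → T →* ℂˣ}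
    (hτ : ∀ t : T, (t : GL (Fin n) ℂ) = diagHom g fun a => τ a t)
    (hchar : ∀ a, τ a ∈ characters T) (γ : T)
    (hγ : ∀ α ∈ roots G T, ‖(α γ : ℂ)‖ = 1) (a : Fin n) : ‖(τ a γ : ℂ)‖ = 1 := by
  let u : Fin n → ℂˣ := fun a => τ a γ
  let v : Fin n → ℝ := fun a => Real.log ‖(u a : ℂ)‖
  have hpos : ∀ a, 0 < ‖(u a : ℂ)‖ := fun a => norm_pos_iff.2 (Units.ne_zero _)
  let w : Fin n → ℂˣ := fun a => Units.mk0 ((Real.exp (v a) : ℝ) : ℂ)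
    (by exact_mod_cast (Real.exp_pos _).ne')
  have hwv : ∀ a, (w a : ℂ) = ‖(u a : ℂ)‖ := fun a => by
    simp only [w, v, Units.val_mk0, Real.exp_log (hpos a)]
  have huw : ∀ e e' : Fin n →₀ ℕ, ∏ a, u a ^ e a = ∏ a, u a ^ e' a →
      ∏ a, w a ^ e a = ∏ a, w a ^ e' a := by
    intro e e' h
    apply Units.ext
    have h' := congrArg (fun z : ℂˣ => ((‖(z : ℂ)‖ : ℝ) : ℂ)) h
    simpa [Units.coe_prod, hwv, norm_prod] using h'
  -- `w` is the positive part of `γ`. Monomial relations among the eigenvalues pass to their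
  -- absolute values, so `N` lies in every closed group containing `γ`.
  let N : Subgroup (GL (Fin n) ℂ) := (monomialClosure w).map (diagHom g)
  have hNG : N ≤ G := by
    rintro _ ⟨y, hy, rfl⟩
    obtain ⟨P, hP⟩ := hG.closed
    have hmem : ∀ x, x ∈ G ↔ ∀ p ∈ P, evalAt x p = 0 := fun x => by
      rw [← SetLike.mem_coe, hP]
      rfl
    rw [hmem]
    intro p hp
    refine evalAt_diagHom_eq_zero g p u y (fun e e' h => hy e e' (huw e e' h)) fun k => ?_
    rw [map_pow, ← hτ γ]
    exact (hmem _).1 (G.pow_mem (hTG γ.2) k) p hp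
  have hcentral : ∀ x ∈ N, ∀ z ∈ G, x * z = z * x := by
    rintro _ ⟨y, hy, rfl⟩ z hz
    refine commute_of_lieAlgebra hG.connected g y (hNG ⟨y, hy, rfl⟩) (fun X hX => ?_) hz
    refine conj_injective g (Matrix.ext fun c d => ?_)
    rw [conj_conj_apply]
    by_cases h0 : ((g : Matrix (Fin n) (Fin n) ℂ) * X *
      ((g⁻¹ : GL (Fin n) ℂ) : Matrix (Fin n) (Fin n) ℂ)) c d = 0
    · rw [h0, mul_zero]
    -- A coordinate occurring in the Lie algebra has as weight a root or the trivial character, so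
    -- the corresponding eigenvalues of `γ` have equal absolute values and `N` fixes the coordinate.
    · have hcd : ‖((τ c / τ d) γ : ℂ)‖ = 1 := by
        by_cases h1 : τ c / τ d = 1
        · rw [h1]
          simp
        · exact hγ _ (div_mem_roots hTG hτ hchar hX h0 h1)
      have : w c = w d := by
        apply Units.ext
        rw [hwv, hwv]
        rw [MonoidHom.div_apply, Units.val_div_eq_div_val, norm_div,
          div_eq_one_iff_eq (hpos d).ne'] at hcd
        exact congrArg _ hcd
      rw [apply_eq_of_mem_monomialClosure hy this, div_self', Units.val_one, one_mul]
  have hN : N = ⊥ := by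
    refine hG.radical N hNG (isZariskiClosed_map_monomialClosure g w)
      (isZariskiConnected_map_monomialClosure g v w fun a => rfl) ⟨fun x hx z => ?_⟩ ?_
    · have h := hcentral x (Subgroup.mem_subgroupOf.1 hx) z z.2
      have : z * x * z⁻¹ = x := by
        rw [mul_inv_eq_iff_eq_mul]
        exact Subtype.ext h.symm
      rwa [this]
    · exact Group.isSolvable_of_comm fun x y => Subtype.ext (hcentral x x.2 y (hNG y.2))
  have hw1 : w = 1 := by
    have : diagHom g w ∈ N := ⟨w, self_mem_monomialClosure w, rfl⟩
    rw [hN, Subgroup.mem_bot] at this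
    exact diagHom_injective g (by rw [this, map_one])
  have := hwv a
  rw [hw1, Pi.one_apply, Units.val_one] at this
  exact_mod_cast this.symm

/-- An element of a discrete group with all eigenvalues of absolute value one has finite order. -/
lemma isOfFinOrder_of_norm_eq_one (Γ : Subgroup (GL (Fin n) ℂ)) (hΓ : DiscreteTopology Γ)
    (g : GL (Fin n) ℂ) (u : Fin n → ℂˣ) (hu : ∀ a, ‖(u a : ℂ)‖ = 1) (hγ : diagHom g u ∈ Γ) :
    IsOfFinOrder (diagHom g u) := by
  -- The image of `Φ` is compact and contains every power of the element; it meets the discrete,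
  -- hence closed, group `Γ` in a finite set.
  let Φ : (Fin n → Circle) → GL (Fin n) ℂ := fun z => diagHom g fun a => Circle.toUnits (z a)
  have hΦ : Continuous Φ := by
    have h1 : ∀ f : (Fin n → Circle) → Fin n → ℂˣ, (∀ a, Continuous fun z => (f z a : ℂ)) →
        Continuous fun z => (diagHom g (f z) : Matrix (Fin n) (Fin n) ℂ) := by
      intro f hf
      simp only [coe_diagHom]
      refine (Continuous.matrix_mul continuous_const ?_).matrix_mul continuous_const
      exact (continuous_pi hf).matrix_diagonal
    refine Units.continuous_iff.2 ⟨h1 _ fun a => ?_, ?_⟩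
    · exact continuous_subtype_val.comp (continuous_apply a)
    · simp only [Φ, ← map_inv]
      refine h1 (fun z => (fun a => Circle.toUnits (z a))⁻¹) fun a => ?_
      have : (fun z : Fin n → Circle => (((fun a => Circle.toUnits (z a))⁻¹ : Fin n → ℂˣ) a : ℂ)) =
          fun z => (((z a)⁻¹ : Circle) : ℂ) := by
        funext z
        simp
      rw [this]
      exact continuous_subtype_val.comp (continuous_apply a).inv
  have hcpt : IsCompact ((Γ : Set (GL (Fin n) ℂ)) ∩ Set.range Φ) :=
    (isCompact_range hΦ).inter_left Subgroup.isClosed_of_discrete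
  have hfin : ((Γ : Set (GL (Fin n) ℂ)) ∩ Set.range Φ).Finite := by
    refine hcpt.finite ?_
    have : IsDiscrete (Γ : Set (GL (Fin n) ℂ)) := ⟨hΓ⟩
    exact this.mono Set.inter_subset_left
  have hpow : ∀ k : ℕ, diagHom g u ^ k ∈ (Γ : Set (GL (Fin n) ℂ)) ∩ Set.range Φ := by
    intro k
    choose z hz using fun a => (⟨⟨u a, mem_sphere_zero_iff_norm.2 (hu a)⟩, Units.ext rfl⟩ :
      ∃ z : Circle, Circle.toUnits z = u a)
    refine ⟨Γ.pow_mem hγ k, fun a => z a ^ k, ?_⟩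
    simp only [Φ, map_pow, hz]
    rw [← map_pow]
    rfl
  by_contra h
  rw [← injective_pow_iff_not_isOfFinOrder] at h
  exact Set.infinite_range_of_injective h (hfin.subset (Set.range_subset_iff.2 hpow))

/-! ### Complex conjugation on tori defined over the reals -/

section RealStructure

/-- Complex conjugation of the matrix entries. -/
noncomputable def conjGL (n : ℕ) : GL (Fin n) ℂ →* GL (Fin n) ℂ :=
  Matrix.GeneralLinearGroup.map (starRingEnd ℂ)

lemma conjGL_apply (t : GL (Fin n) ℂ) (i j : Fin n) :
    (conjGL n t : Matrix (Fin n) (Fin n) ℂ) i j = starRingEnd ℂ (t i j) := rfl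

lemma conjGL_mem {T : Subgroup (GL (Fin n) ℂ)}
    (hT : IsDefinedOver ℝ (T : Set (GL (Fin n) ℂ))) {t : GL (Fin n) ℂ} (ht : t ∈ T) :
    conjGL n t ∈ T := by
  obtain ⟨P, hP⟩ := hT
  have hmem : ∀ x, x ∈ T ↔ ∀ p ∈ P, evalAt x p = 0 := fun x => by
    rw [← SetLike.mem_coe, hP]
    rfl
  rw [hmem] at ht ⊢
  intro p hp
  have h := congrArg (starRingEnd ℂ) (ht p hp)
  rw [map_zero] at h
  rw [← h, evalAt, evalAt, MvPolynomial.aeval_def, MvPolynomial.aeval_def,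
    MvPolynomial.hom_eval₂]
  congr 1
  ext x
  simp

lemma evalAt_conjGL (t : GL (Fin n) ℂ) (p : MvPolynomial (Fin n × Fin n) ℂ) :
    starRingEnd ℂ (evalAt (conjGL n t) p) = evalAt t (MvPolynomial.map (starRingEnd ℂ) p) := by
  rw [evalAt, evalAt, MvPolynomial.aeval_def, MvPolynomial.aeval_def, MvPolynomial.hom_eval₂,
    MvPolynomial.eval₂_map]
  congr 1
  funext ij
  exact Complex.conj_conj _

/-- At a real point, the squared absolute value of a character of a torus defined over `ℝ` is
itself the value of a character. -/
lemma exists_character_normSq {T : Subgroup (GL (Fin n) ℂ)}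
    (hT : IsDefinedOver ℝ (T : Set (GL (Fin n) ℂ))) {χ : T →* ℂˣ} (hχ : χ ∈ characters T)
    {γ : T} (hγ : conjGL n γ = γ) :
    ∃ ψ ∈ characters T, (ψ γ : ℂ) = ((‖(χ γ : ℂ)‖ ^ 2 : ℝ) : ℂ) := by
  let σ : T →* T := ((conjGL n).comp T.subtype).codRestrict T fun t => conjGL_mem hT t.2
  -- Conjugating both argument and value amounts to conjugating the coefficients, so `χ'` is again
  -- regular; at a real point it takes the conjugate value of `χ`.
  let χ' : T →* ℂˣ := (Units.map (starRingEnd ℂ : ℂ →* ℂ)).comp (χ.comp σ)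
  have hσ : ∀ t : T, ((σ t : T) : GL (Fin n) ℂ) = conjGL n t := fun t => rfl
  have hχ'v : ∀ t : T, (χ' t : ℂ) = starRingEnd ℂ (χ (σ t) : ℂ) := fun t => rfl
  have hχ' : χ' ∈ characters T := by
    obtain ⟨p, k, hp⟩ := hχ
    refine ⟨MvPolynomial.map (starRingEnd ℂ) p, k, fun t => ?_⟩
    rw [← evalAt_conjGL, ← hσ, ← hp, map_mul, map_pow, hχ'v, hσ]
    congr 2
    have : (conjGL n t : Matrix (Fin n) (Fin n) ℂ) = (starRingEnd ℂ).mapMatrix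
      ((t : GL (Fin n) ℂ) : Matrix (Fin n) (Fin n) ℂ) := rfl
    rw [this, ← RingHom.map_det, Complex.conj_conj]
  refine ⟨χ * χ', (characterGroup T).mul_mem hχ hχ', ?_⟩
  have hγσ : σ γ = γ := Subtype.ext hγ
  rw [MonoidHom.mul_apply, Units.val_mul, hχ'v, hγσ, Complex.mul_conj, Complex.normSq_eq_norm_sq]

end RealStructure

/-! ### From relations among logarithms to relations among characters -/

section LogValues

/-- The logarithms of the absolute values at `γ` of the characters of `T`. -/
noncomputable def logValues (T : Subgroup (GL (Fin n) ℂ)) (γ : T) : AddSubgroup ℝ where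
  carrier := {x | ∃ χ ∈ characters T, x = Real.log ‖(χ γ : ℂ)‖}
  zero_mem' := ⟨1, (characterGroup T).one_mem, by simp⟩
  add_mem' := by
    rintro _ _ ⟨χ, hχ, rfl⟩ ⟨ψ, hψ, rfl⟩
    refine ⟨χ * ψ, (characterGroup T).mul_mem hχ hψ, ?_⟩
    rw [MonoidHom.mul_apply, Units.val_mul, norm_mul, Real.log_mul] <;> simp
  neg_mem' := by
    rintro _ ⟨χ, hχ, rfl⟩
    refine ⟨χ⁻¹, (characterGroup T).inv_mem hχ, ?_⟩
    rw [MonoidHom.inv_apply, Units.val_inv_eq_inv_val, norm_inv, Real.log_inv]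

/-- The logarithms of the absolute values at semisimple elements of `Γ` of the characters of the
maximal tori. -/
def torusLogs (G Γ : Subgroup (GL (Fin n) ℂ)) : Set ℝ :=
  {x | ∃ δ ∈ Γ, IsSemisimpleElt δ ∧ ∃ (S : Subgroup (GL (Fin n) ℂ)) (hδ : δ ∈ S),
    IsMaximalTorusOver ℝ G S ∧ x ∈ logValues S ⟨δ, hδ⟩}

lemma neg_mem_torusLogs {G Γ : Subgroup (GL (Fin n) ℂ)} {x : ℝ} (hx : x ∈ torusLogs G Γ) :
    -x ∈ torusLogs G Γ := by
  obtain ⟨δ, hδ, hss, S, hS, hmax, hx⟩ := hx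
  exact ⟨δ, hδ, hss, S, hS, hmax, neg_mem hx⟩

/-- The factor `2` is there because `|χ|²`, rather than `|χ|`, is known to be a character value. -/
lemma exists_character_exp {T : Subgroup (GL (Fin n) ℂ)}
    (hT : IsDefinedOver ℝ (T : Set (GL (Fin n) ℂ))) {γ : T} (hγ : conjGL n γ = γ) {x : ℝ}
    (hx : x ∈ logValues T γ) : ∃ ψ ∈ characters T, (ψ γ : ℂ) = (Real.exp (2 * x) : ℝ) := by
  obtain ⟨χ, hχ, rfl⟩ := hx
  obtain ⟨ψ, hψ, h⟩ := exists_character_normSq hT hχ hγ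
  refine ⟨ψ, hψ, ?_⟩
  rw [h, two_mul, Real.exp_add, Real.exp_log (norm_pos_iff.2 (Units.ne_zero _)), sq]

/-- Independence of the logarithms of characters at multiplicatively independent elements which
are not weakly contained in `Γ₂`, with integral coefficients. -/
lemma eq_zero_of_sum_mem_closure {n₁ n₂ m : ℕ} {G₁ : Subgroup (GL (Fin n₁) ℂ)}
    {G₂ Γ₂ : Subgroup (GL (Fin n₂) ℂ)} {γ : Fin m → GL (Fin n₁) ℂ}
    {T : Fin m → Subgroup (GL (Fin n₁) ℂ)} (hγ : ∀ j, γ j ∈ T j)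
    (hT : ∀ j, IsMaximalTorusOver ℝ G₁ (T j))
    (hindep : ∀ χ : (j : Fin m) → (T j →* ℂˣ), (∀ j, χ j ∈ characters (T j)) →
      ∏ j, χ j ⟨γ j, hγ j⟩ = 1 → ∀ j, χ j ⟨γ j, hγ j⟩ = 1)
    (hnot : ¬ WeaklyContained ℝ G₁ G₂ γ Γ₂)
    (hreal₁ : ∀ j, conjGL n₁ (γ j) = γ j) (hreal₂ : ∀ δ ∈ Γ₂, conjGL n₂ δ = δ)
    {x : Fin m → ℝ} (hx : ∀ j, x j ∈ logValues (T j) ⟨γ j, hγ j⟩)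
    (hsum : ∑ j, x j ∈ AddSubgroup.closure (torusLogs G₂ Γ₂)) (j : Fin m) : x j = 0 := by
  rw [← AddSubgroup.mem_toAddSubmonoid, AddSubgroup.closure_toAddSubmonoid] at hsum
  obtain ⟨L, hL, hLs⟩ := AddSubmonoid.exists_list_of_mem_closure hsum
  have hL' : ∀ k : Fin L.length, L.get k ∈ torusLogs G₂ Γ₂ := fun k => by
    rcases hL _ (L.get_mem k) with h | h
    · exact h
    · have := neg_mem_torusLogs h
      rwa [neg_neg] at this
  choose δ hδ hss S hS hSmax hy using hL'
  choose ψ hψ hψv using fun k =>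
    exists_character_exp (hSmax k).definedOver (γ := ⟨δ k, hS k⟩) (hreal₂ _ (hδ k)) (hy k)
  choose χ hχ hχv using fun j =>
    exists_character_exp (hT j).definedOver (γ := ⟨γ j, hγ j⟩) (hreal₁ j) (hx j)
  have h1 : ((∏ j, χ j ⟨γ j, hγ j⟩ : ℂˣ) : ℂ) = (Real.exp (2 * ∑ j, x j) : ℝ) := by
    simp only [Units.coe_prod, hχv]
    rw [Finset.mul_sum, Real.exp_sum, Complex.ofReal_prod]
  have h2 : ((∏ k, ψ k ⟨δ k, hS k⟩ : ℂˣ) : ℂ) = (Real.exp (2 * ∑ j, x j) : ℝ) := by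
    simp only [Units.coe_prod, hψv]
    rw [← hLs, ← Complex.ofReal_prod, ← Real.exp_sum, ← Finset.mul_sum]
    congr 3
    conv_rhs => rw [← List.ofFn_get L, List.sum_ofFn]
  have heq : ∏ j, χ j ⟨γ j, hγ j⟩ = ∏ k, ψ k ⟨δ k, hS k⟩ := Units.ext (h1.trans h2.symm)
  -- A common value different from one would be exactly a weak containment.
  have hone : ∏ k, ψ k ⟨δ k, hS k⟩ = 1 := by
    by_contra hne
    exact hnot ⟨L.length, δ, fun k => ⟨hδ k, hss k⟩, T, hγ, S, hS, χ, ψ,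
      fun j => ⟨hT j, hχ j⟩, fun k => ⟨hSmax k, hψ k⟩, heq, hne⟩
  have := hindep χ hχ (heq.trans hone) j
  have h3 := hχv j
  rw [this, Units.val_one] at h3
  have h4 : Real.exp (2 * x j) = 1 := by exact_mod_cast h3.symm
  rw [Real.exp_eq_one_iff] at h4
  linarith

lemma exists_nsmul_mem_closure {A : Set ℝ} {x : ℝ} (hx : x ∈ Submodule.span ℚ A) :
    ∃ N : ℕ, N ≠ 0 ∧ N • x ∈ AddSubgroup.closure A := by
  induction hx using Submodule.span_induction with
  | mem x hx => exact ⟨1, one_ne_zero, by rw [one_smul]; exact AddSubgroup.subset_closure hx⟩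
  | zero => exact ⟨1, one_ne_zero, by simp⟩
  | add x y _ _ hx hy =>
    obtain ⟨N, hN, hx⟩ := hx
    obtain ⟨M, hM, hy⟩ := hy
    refine ⟨N * M, mul_ne_zero hN hM, ?_⟩
    rw [smul_add]
    refine add_mem ?_ ?_
    · rw [mul_comm, mul_smul]
      exact nsmul_mem hx M
    · rw [mul_smul]
      exact nsmul_mem hy N
  | smul q x _ hx =>
    obtain ⟨N, hN, hx⟩ := hx
    refine ⟨N * q.den, mul_ne_zero hN q.den_ne_zero, ?_⟩
    have : (N * q.den) • q • x = q.num • N • x := by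
      simp only [nsmul_eq_mul, zsmul_eq_mul, Rat.smul_def, Nat.cast_mul]
      have : (q : ℝ) * q.den = q.num := by exact_mod_cast Rat.mul_den_eq_num q
      rw [← this]
      ring
    rw [this]
    exact zsmul_mem hx _

/-- Independence with rational coefficients. -/
lemma eq_zero_of_sum_mem_span {n₁ n₂ m : ℕ} {G₁ : Subgroup (GL (Fin n₁) ℂ)}
    {G₂ Γ₂ : Subgroup (GL (Fin n₂) ℂ)} {γ : Fin m → GL (Fin n₁) ℂ}
    {T : Fin m → Subgroup (GL (Fin n₁) ℂ)} (hγ : ∀ j, γ j ∈ T j)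
    (hT : ∀ j, IsMaximalTorusOver ℝ G₁ (T j))
    (hindep : ∀ χ : (j : Fin m) → (T j →* ℂˣ), (∀ j, χ j ∈ characters (T j)) →
      ∏ j, χ j ⟨γ j, hγ j⟩ = 1 → ∀ j, χ j ⟨γ j, hγ j⟩ = 1)
    (hnot : ¬ WeaklyContained ℝ G₁ G₂ γ Γ₂)
    (hreal₁ : ∀ j, conjGL n₁ (γ j) = γ j) (hreal₂ : ∀ δ ∈ Γ₂, conjGL n₂ δ = δ)
    {x : Fin m → ℝ} (hx : ∀ j, x j ∈ Submodule.span ℚ (logValues (T j) ⟨γ j, hγ j⟩ : Set ℝ))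
    (hsum : ∑ j, x j ∈ Submodule.span ℚ (torusLogs G₂ Γ₂)) (j : Fin m) : x j = 0 := by
  choose N hN hNx using fun j => exists_nsmul_mem_closure (hx j)
  simp only [AddSubgroup.closure_eq] at hNx
  obtain ⟨M, hM, hMx⟩ := exists_nsmul_mem_closure hsum
  -- One multiplier must serve all `x j` and their sum, so that the relation between them is
  -- preserved.
  have hP : M * ∏ j, N j ≠ 0 := mul_ne_zero hM (Finset.prod_ne_zero_iff.2 fun j _ => hN j)
  have h := eq_zero_of_sum_mem_closure (x := fun j => (M * ∏ j, N j) • x j) hγ hT hindep hnot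
    hreal₁ hreal₂ (fun j => ?_) ?_ j
  · exact (smul_eq_zero.1 h).resolve_left hP
  · obtain ⟨c, hc⟩ : N j ∣ M * ∏ j, N j :=
      (Finset.dvd_prod_of_mem N (Finset.mem_univ j)).mul_left M
    simp only [hc]
    rw [mul_comm, mul_smul]
    exact nsmul_mem (hNx j) c
  · rw [← Finset.smul_sum, mul_comm, mul_smul]
    exact nsmul_mem hMx _

end LogValues

/-! ### Eigenvalues and root values at rational points are algebraic -/

section Rational

variable {K : Subfield ℝ} {G : Subgroup (GL (Fin n) ℂ)} {γ : GL (Fin n) ℂ}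

lemma conjGL_eq_of_mem_rationalPoints (hγ : γ ∈ rationalPoints K G) : conjGL n γ = γ := by
  obtain ⟨-, γ₀, rfl⟩ := hγ
  apply Units.ext
  ext i j
  rw [conjGL_apply]
  exact Complex.conj_ofReal _

/-- The `u a` are the eigenvalues of a matrix over `K`, hence roots of its characteristic
polynomial. -/
lemma isAlgebraic_of_mem_rationalPoints (hγ : γ ∈ rationalPoints K G) {g : GL (Fin n) ℂ}
    {u : Fin n → ℂˣ} (hu : γ = diagHom g u) (a : Fin n) : IsAlgebraic K (u a : ℂ) := by
  obtain ⟨-, γ₀, hγ₀⟩ := hγ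
  refine ⟨(γ₀ : Matrix (Fin n) (Fin n) K).charpoly, (Matrix.charpoly_monic _).ne_zero, ?_⟩
  have h1 : (γ : Matrix (Fin n) (Fin n) ℂ) =
      (γ₀ : Matrix (Fin n) (Fin n) K).map (algebraMap K ℂ) := by
    rw [← hγ₀]
    rfl
  rw [Polynomial.aeval_def, ← Polynomial.eval_map, ← Matrix.charpoly_map, ← h1, hu, coe_diagHom]
  have h2 : (((g⁻¹ : GL (Fin n) ℂ) : Matrix (Fin n) (Fin n) ℂ) *
      Matrix.diagonal (fun a => (u a : ℂ)) * (g : Matrix (Fin n) (Fin n) ℂ)).charpoly =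
      (Matrix.diagonal (fun a => (u a : ℂ))).charpoly := by
    rw [Matrix.coe_units_inv]
    exact Matrix.charpoly_units_conj' g _
  rw [h2, Matrix.charpoly_diagonal, Polynomial.eval_prod]
  exact Finset.prod_eq_zero (Finset.mem_univ a) (by simp)

/-- Root values at `K`-rational points are algebraic over `K`. -/
lemma isAlgebraic_norm_root (hγ : γ ∈ rationalPoints K G) {T : Subgroup (GL (Fin n) ℂ)}
    (hT : IsTorus T) (hγT : γ ∈ T) {α : T →* ℂˣ} (hα : α ∈ roots G T) :
    IsAlgebraic K ‖(α ⟨γ, hγT⟩ : ℂ)‖ := by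
  obtain ⟨g, hg⟩ := hT.diagonalizable
  obtain ⟨τ, hτ, -⟩ := exists_coords hg
  obtain ⟨a, b, rfl⟩ := exists_eq_div_of_mem_roots hτ hα
  have hz : IsAlgebraic K (((τ a / τ b) ⟨γ, hγT⟩ : ℂˣ) : ℂ) := by
    rw [MonoidHom.div_apply, Units.val_div_eq_div_val, div_eq_mul_inv]
    exact (isAlgebraic_of_mem_rationalPoints hγ (hτ ⟨γ, hγT⟩) a).mul
      (isAlgebraic_of_mem_rationalPoints hγ (hτ ⟨γ, hγT⟩) b).inv
  set z : ℂ := (((τ a / τ b) ⟨γ, hγT⟩ : ℂˣ) : ℂ)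
  -- Since `K` is real, the conjugate of `z` is a root of the same polynomial; then `‖z‖ ^ 2` is a
  -- product of algebraic numbers.
  have hconj : IsAlgebraic K (starRingEnd ℂ z) := by
    obtain ⟨p, hp0, hp⟩ := hz
    refine ⟨p, hp0, ?_⟩
    have h := congrArg (starRingEnd ℂ) hp
    rw [map_zero, Polynomial.aeval_def, Polynomial.hom_eval₂] at h
    rw [Polynomial.aeval_def, ← h]
    congr 1
    ext x
    exact (Complex.conj_ofReal _).symm
  have hsq : IsAlgebraic K (((‖z‖ ^ 2 : ℝ)) : ℂ) := by
    rw [← Complex.normSq_eq_norm_sq, ← Complex.mul_conj]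
    exact hz.mul hconj
  have hsq' : IsAlgebraic K (‖z‖ ^ 2 : ℝ) :=
    (isAlgebraic_algebraMap_iff (A := ℂ) (algebraMap ℝ ℂ).injective).1 hsq
  exact hsq'.of_pow two_pos

end Rational

/-! ### Lengths, change of torus, and nonvanishing of a root logarithm -/

section Length

variable {G : Subgroup (GL (Fin n) ℂ)} {γ : GL (Fin n) ℂ}

lemma lam_eq_zero (h : ¬ ∃ T : Subgroup (GL (Fin n) ℂ), IsMaximalTorusOver ℝ G T ∧ γ ∈ T) :
    lam G γ = 0 := dif_neg h

lemma exists_lam_eq (h : ∃ T : Subgroup (GL (Fin n) ℂ), IsMaximalTorusOver ℝ G T ∧ γ ∈ T) :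
    ∃ (T : Subgroup (GL (Fin n) ℂ)) (hT : IsMaximalTorusOver ℝ G T) (hγ : γ ∈ T),
      lam G γ = Real.sqrt (∑ α ∈ (finite_roots (G := G) hT.maximal.prop.1).toFinset,
        (Real.log ‖(α ⟨γ, hγ⟩ : ℂ)‖) ^ 2) := by
  refine ⟨h.choose, h.choose_spec.1, h.choose_spec.2, ?_⟩
  rw [lam, dif_pos h, lengthWrt, finsum_mem_eq_finite_toFinset_sum]

/-- A root value at `γ` is the value of a character of any other torus containing `γ`. -/
lemma log_root_mem_logValues {T T' : Subgroup (GL (Fin n) ℂ)} (hT' : IsTorus T')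
    (hγ : γ ∈ T) (hγ' : γ ∈ T') {α : T →* ℂˣ} (hα : α ∈ roots G T) :
    Real.log ‖(α ⟨γ, hγ⟩ : ℂ)‖ ∈ logValues T' ⟨γ, hγ'⟩ := by
  obtain ⟨g, hg⟩ := hT'.diagonalizable
  obtain ⟨τ, hτ, hchar⟩ := exists_coords hg
  obtain ⟨-, -, X, -, hX0, hX⟩ := hα
  -- A root vector for `T` is an eigenvector of `Ad γ`, and its eigenvalue can be read off in
  -- coordinates diagonalizing the other torus `T'`.
  obtain ⟨a, b, hab⟩ := exists_eq_div g hX0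
  refine ⟨τ a / τ b, (characterGroup T').div_mem (hchar a) (hchar b), ?_⟩
  have h1 : γ = diagHom g fun a => τ a ⟨γ, hγ'⟩ := hτ ⟨γ, hγ'⟩
  have h2 := hX ⟨γ, hγ⟩
  simp only at h2
  have h3 := hab (fun a => τ a ⟨γ, hγ'⟩) (α ⟨γ, hγ⟩) (by rw [← h1]; exact h2)
  rw [h3]
  rfl

/-- A nontrivial element of a discrete torsion-free group in a semisimple group has a root value
which is not of absolute value one. -/
lemma exists_root_log_ne_zero (hG : IsSemisimpleGroup G) {Γ : Subgroup (GL (Fin n) ℂ)}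
    (hΓ : DiscreteTopology Γ) (htf : ∀ g ∈ Γ, IsOfFinOrder g → g = 1) (hγΓ : γ ∈ Γ) (hγ1 : γ ≠ 1)
    {T : Subgroup (GL (Fin n) ℂ)} (hT : IsTorus T) (hTG : T ≤ G) (hγ : γ ∈ T) :
    ∃ α ∈ roots G T, Real.log ‖(α ⟨γ, hγ⟩ : ℂ)‖ ≠ 0 := by
  by_contra! h
  obtain ⟨g, hg⟩ := hT.diagonalizable
  obtain ⟨τ, hτ, hchar⟩ := exists_coords hg
  have h1 : γ = diagHom g fun a => τ a ⟨γ, hγ⟩ := hτ ⟨γ, hγ⟩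
  have hnorm := norm_eq_one_of_roots hG hTG hτ hchar ⟨γ, hγ⟩ fun α hα =>
    Real.eq_one_of_pos_of_log_eq_zero (norm_pos_iff.2 (Units.ne_zero _)) (h α hα)
  refine hγ1 (htf γ hγΓ ?_)
  rw [h1]
  exact isOfFinOrder_of_norm_eq_one Γ hΓ g _ hnorm (h1 ▸ hγΓ)

end Length

/-! ### Relative algebraic closure and rank in the algebraic independence matroid -/

section Transcendence

open AlgebraicIndependent

/-- The relative algebraic closure in `ℝ` of the field generated by `X`. -/
noncomputable def algClosureField (X : Set ℝ) : Subfield ℝ :=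
  have h : ∃ S : Subalgebra ℚ ℝ, (S : Set ℝ) = (matroid ℚ ℝ).closure X ∧
      ∀ a : ℝ, IsAlgebraic S a → a ∈ (matroid ℚ ℝ).closure X :=
    matroid_isFlat_iff.1 ((matroid ℚ ℝ).isFlat_closure X)
  { h.choose with
    neg_mem' := fun {x} hx => h.choose.neg_mem hx
    inv_mem' := fun x hx => by
      have hx' : IsAlgebraic h.choose x⁻¹ :=
        (isAlgebraic_algebraMap (⟨x, hx⟩ : h.choose)).inv
      have := h.choose_spec.2 _ hx'
      rw [← h.choose_spec.1] at this
      exact this }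

lemma coe_algClosureField (X : Set ℝ) :
    (algClosureField X : Set ℝ) = (matroid ℚ ℝ).closure X :=
  (matroid_isFlat_iff.1 ((matroid ℚ ℝ).isFlat_closure X)).choose_spec.1

lemma mem_algClosureField {X : Set ℝ} {x : ℝ} :
    x ∈ algClosureField X ↔ x ∈ (matroid ℚ ℝ).closure X := by
  rw [← SetLike.mem_coe, coe_algClosureField]

lemma subset_algClosureField (X : Set ℝ) : X ⊆ algClosureField X := by
  rw [coe_algClosureField]
  exact (matroid ℚ ℝ).subset_closure X (Set.subset_univ X)

lemma algClosureField_le {X Y : Set ℝ} (h : X ⊆ algClosureField Y) :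
    algClosureField X ≤ algClosureField Y := fun x hx => by
  rw [mem_algClosureField] at hx ⊢
  rw [coe_algClosureField] at h
  exact Matroid.closure_subset_closure_of_subset_closure h hx

lemma algClosureField_mono {X Y : Set ℝ} (h : X ⊆ Y) : algClosureField X ≤ algClosureField Y :=
  algClosureField_le (h.trans (subset_algClosureField Y))

/-- Flats of the algebraic independence matroid are relatively algebraically closed; it remains to
move the polynomial from `E` to the flat. -/
lemma mem_algClosureField_of_isAlgebraic {X : Set ℝ} {E : Subfield ℝ}
    (hE : E ≤ algClosureField X) {x : ℝ} (hx : IsAlgebraic E x) : x ∈ algClosureField X := by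
  obtain ⟨S, hS, hSalg⟩ := matroid_isFlat_iff.1 ((matroid ℚ ℝ).isFlat_closure X)
  rw [mem_algClosureField]
  apply hSalg
  have hES : ∀ y : E, (y : ℝ) ∈ S := fun y => by
    rw [← SetLike.mem_coe, hS, ← coe_algClosureField]
    exact hE y.2
  let φ : E →+* S := E.subtype.codRestrict S hES
  obtain ⟨p, hp0, hp⟩ := hx
  refine ⟨p.map φ, (Polynomial.map_ne_zero_iff φ.injective).2 hp0, ?_⟩
  rw [Polynomial.aeval_def, Polynomial.eval₂_map]
  exact hp

lemma smul_mem_algClosureField {X : Set ℝ} (q : ℚ) {x : ℝ} (hx : x ∈ algClosureField X) :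
    q • x ∈ algClosureField X := by
  rw [Rat.smul_def]
  exact mul_mem (SubfieldClass.ratCast_mem _ q) hx

/-- The span over `ℚ` of `X` is contained in the field generated by `X`. -/
lemma span_subset_algClosureField {X Y : Set ℝ} (h : X ⊆ algClosureField Y) {x : ℝ}
    (hx : x ∈ Submodule.span ℚ X) : x ∈ algClosureField Y := by
  induction hx using Submodule.span_induction with
  | mem x hx => exact h hx
  | zero => exact zero_mem _
  | add x y _ _ hx hy => exact add_mem hx hy
  | smul q x _ hx => exact smul_mem_algClosureField q hx

/-- A transcendence basis of a subfield of `ℝ`, as a set of real numbers. -/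
lemma exists_algebraicIndependent_of_le_trdeg (E : IntermediateField ℚ ℝ) (N : ℕ)
    (h : (N : Cardinal) ≤ Algebra.trdeg ℚ E) :
    ∃ B : Set ℝ, B ⊆ E ∧ (matroid ℚ ℝ).Indep B ∧ (N : ℕ∞) ≤ B.encard := by
  obtain ⟨s, hs⟩ := exists_isTranscendenceBasis ℚ E
  refine ⟨(fun x : E => (x : ℝ)) '' s, ?_, ?_, ?_⟩
  · rintro _ ⟨x, -, rfl⟩
    exact x.2
  · rw [matroid_indep_iff]
    have h1 : AlgebraicIndependent ℚ fun x : s => ((x : E) : ℝ) :=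
      hs.1.map' (f := E.val) E.val.injective
    have h2 := h1.to_subtype_range
    have : Set.range (fun x : s => ((x : E) : ℝ)) = (fun x : E => (x : ℝ)) '' s := by
      ext y
      simp
    rw [this] at h2
    exact h2
  · rw [Function.Injective.encard_image Subtype.val_injective]
    rw [← hs.cardinalMk_eq_trdeg] at h
    have := OrderHomClass.mono Cardinal.toENat h
    rwa [map_natCast] at this

/-- Schanuel's conjecture bounds the size of a set over which real numbers and their exponentials
are algebraic. -/
lemma SchanuelConjecture.le_encard (hS : SchanuelConjecture) {N : ℕ} {z : Fin N → ℝ}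
    (hz : LinearIndependent ℚ z) {S : Set ℝ} (h1 : ∀ i, z i ∈ algClosureField S)
    (h2 : ∀ i, Real.exp (z i) ∈ algClosureField S) : (N : ℕ∞) ≤ S.encard := by
  let ι : ℝ →ₐ[ℚ] ℂ := (Complex.ofRealAm).restrictScalars ℚ
  have hι : ∀ x : ℝ, ι x = (x : ℂ) := fun x => rfl
  have hzC : LinearIndependent ℚ fun i => ι (z i) :=
    hz.map' ι.toLinearMap (LinearMap.ker_eq_bot.2 ι.injective)
  have h := hS N _ hzC
  -- The conjecture speaks of a subfield of `ℂ`; `E` is its real copy, so that the count can be made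
  -- by matroid rank in `ℝ`.
  let E : IntermediateField ℚ ℝ :=
    IntermediateField.adjoin ℚ (Set.range z ∪ Set.range fun i => Real.exp (z i))
  have hE : IntermediateField.adjoin ℚ (Set.range (fun i => ι (z i)) ∪
      Set.range fun i => Complex.exp (ι (z i))) = E.map ι := by
    rw [IntermediateField.adjoin_map, Set.image_union, ← Set.range_comp, ← Set.range_comp]
    congr 3
    funext i
    simp only [Function.comp_apply, hι, Complex.ofReal_exp]
  let e : E ≃ₐ[ℚ] IntermediateField.adjoin ℚ (Set.range (fun i => ι (z i)) ∪
      Set.range fun i => Complex.exp (ι (z i))) :=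
    AlgEquiv.ofRingEquiv (f := ((IntermediateField.equivMap E ι).trans
      (IntermediateField.equivOfEq hE.symm)).toRingEquiv) fun q => by
        rw [eq_ratCast, map_ratCast, eq_ratCast]
  have hequiv := e.lift_trdeg_eq
  rw [Cardinal.lift_id, Cardinal.lift_id] at hequiv
  rw [← hequiv] at h
  obtain ⟨B, hBE, hBind, hBN⟩ := exists_algebraicIndependent_of_le_trdeg E N h
  have hEle : E.toSubfield ≤ algClosureField S := by
    rw [IntermediateField.adjoin_toSubfield, Subfield.closure_le]
    rintro x (⟨q, rfl⟩ | ⟨i, rfl⟩ | ⟨i, rfl⟩)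
    · exact SubfieldClass.ratCast_mem _ q
    · exact h1 i
    · exact h2 i
  have hBS : B ⊆ (matroid ℚ ℝ).closure S := by
    rw [← coe_algClosureField]
    exact fun x hx => hEle (hBE hx)
  calc (N : ℕ∞) ≤ B.encard := hBN
    _ ≤ (matroid ℚ ℝ).eRk ((matroid ℚ ℝ).closure S) := hBind.encard_le_eRk_of_subset hBS
    _ = (matroid ℚ ℝ).eRk S := (matroid ℚ ℝ).eRk_closure_eq S
    _ ≤ S.encard := (matroid ℚ ℝ).eRk_le_encard S

/-- A field of finite transcendence degree is algebraic over finitely many of its elements. -/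
lemma exists_finite_le_algClosureField (K : Subfield ℝ) (d : ℕ)
    (hK : Algebra.trdeg ℚ K = (d : Cardinal)) :
    ∃ D : Set ℝ, D.encard = d ∧ K ≤ algClosureField D := by
  obtain ⟨s, hs⟩ := exists_isTranscendenceBasis ℚ K
  refine ⟨Subtype.val '' s, ?_, fun x hx => ?_⟩
  · rw [Function.Injective.encard_image Subtype.val_injective]
    rw [← hs.cardinalMk_eq_trdeg] at hK
    rw [Set.encard, ENat.card, hK, map_natCast]
  · obtain ⟨p, hp0, hp⟩ := hs.isAlgebraic_field.isAlgebraic (⟨x, hx⟩ : K)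
    refine mem_algClosureField_of_isAlgebraic (E := algClosureField (Subtype.val '' s)) le_rfl ?_
    let φ : IntermediateField.adjoin ℚ (Set.range (Subtype.val : s → K)) →+*
        algClosureField (Subtype.val '' s) :=
      (K.subtype.comp (algebraMap (IntermediateField.adjoin ℚ
        (Set.range (Subtype.val : s → K))) K)).codRestrict _ fun y => by
          have : (IntermediateField.adjoin ℚ (Set.range (Subtype.val : s → K))).toSubfield ≤
              (algClosureField (Subtype.val '' s)).comap K.subtype := by
            rw [IntermediateField.adjoin_toSubfield, Subfield.closure_le]
            rintro z (⟨q, rfl⟩ | ⟨i, rfl⟩)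
            · simp
            · exact subset_algClosureField _ ⟨i, i.2, rfl⟩
          exact this y.2
    refine ⟨p.map φ, (Polynomial.map_ne_zero_iff φ.injective).2 hp0, ?_⟩
    rw [Polynomial.aeval_def, Polynomial.eval₂_map]
    have := congrArg K.subtype hp
    rw [Polynomial.aeval_def, Polynomial.hom_eval₂, map_zero] at this
    exact this

/-- An extension of `F` of transcendence degree `r` is algebraic over `F` and `r` of its
elements. -/
lemma exists_subset_algClosureField (F : Subfield ℝ) (X : Set ℝ) (hF : F ≤ algClosureField X) (r : ℕ)
    (L : IntermediateField F ℝ) (hr : Algebra.trdeg F L = (r : Cardinal)) :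
    ∃ Y : Set ℝ, Y.encard = r ∧ (L : Set ℝ) ⊆ algClosureField (X ∪ Y) := by
  have : FaithfulSMul F L :=
    (faithfulSMul_iff_algebraMap_injective F L).2 (algebraMap F L).injective
  obtain ⟨s, hs⟩ := exists_isTranscendenceBasis F L
  refine ⟨Subtype.val '' s, ?_, fun x hxL => ?_⟩
  · rw [Function.Injective.encard_image Subtype.val_injective]
    rw [← hs.cardinalMk_eq_trdeg] at hr
    rw [Set.encard, ENat.card, hr, map_natCast]
  · set Z := algClosureField (X ∪ Subtype.val '' s) with hZ
    obtain ⟨p, hp0, hp⟩ := hs.isAlgebraic_field.isAlgebraic (⟨x, hxL⟩ : L)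
    refine mem_algClosureField_of_isAlgebraic (E := Z) le_rfl ?_
    let φ : IntermediateField.adjoin F (Set.range (Subtype.val : s → L)) →+* Z :=
      ((algebraMap L ℝ).comp (algebraMap (IntermediateField.adjoin F
        (Set.range (Subtype.val : s → L))) L)).codRestrict _ fun y => by
          have : (IntermediateField.adjoin F (Set.range (Subtype.val : s → L))).toSubfield ≤
              Z.comap (algebraMap L ℝ) := by
            rw [IntermediateField.adjoin_toSubfield, Subfield.closure_le]
            rintro z (⟨q, rfl⟩ | ⟨i, rfl⟩)
            · exact algClosureField_mono Set.subset_union_left (hF q.2)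
            · exact subset_algClosureField _ (Or.inr ⟨i, i.2, rfl⟩)
          exact this y.2
    refine ⟨p.map φ, (Polynomial.map_ne_zero_iff φ.injective).2 hp0, ?_⟩
    rw [Polynomial.aeval_def, Polynomial.eval₂_map]
    have := congrArg (algebraMap L ℝ) hp
    rw [Polynomial.aeval_def, Polynomial.hom_eval₂, map_zero] at this
    exact this

end Transcendence

/-! ### The transcendence count -/

section Counting

open AlgebraicIndependent

/-- From the sum of the squares of linear forms and all variables but one, the remaining variable
is obtained by solving a quadratic equation. -/
lemma mem_algClosureField_of_sum_sq {ι : Type*} [Fintype ι] {β : Set ℝ}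
    (hβ : LinearIndepOn ℚ id β) {e : ℝ} (he : e ∈ β) {ℓ : ι → ℝ}
    (hℓ : ∀ i, ℓ i ∈ Submodule.span ℚ β) (heℓ : ∃ i, ℓ i = e) {lam : ℝ}
    (hlam : lam ^ 2 = ∑ i, ℓ i ^ 2) {X : Set ℝ} (hlamX : lam ∈ algClosureField X)
    (hX : β \ {e} ⊆ algClosureField X) : e ∈ algClosureField X := by
  have hdec : ∀ i, ∃ (c : ℚ) (z : ℝ), z ∈ Submodule.span ℚ (β \ {e}) ∧ ℓ i = c * e + z := by
    intro i
    have h := hℓ i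
    rw [← Set.insert_sdiff_self_of_mem he, Submodule.mem_span_insert] at h
    obtain ⟨c, z, hz, h⟩ := h
    exact ⟨c, z, hz, by rw [h, Rat.smul_def]⟩
  choose c z hz hcz using hdec
  have hzX : ∀ i, z i ∈ algClosureField X := fun i => span_subset_algClosureField hX (hz i)
  have hcX : ∀ i, (c i : ℝ) ∈ algClosureField X := fun i => SubfieldClass.ratCast_mem _ _
  -- This is the coefficient of `e ^ 2` in the sum of squares. The form equal to `e` has nonzero
  -- coefficient, since `e` is not in the span of the rest of `β`.
  have hpos : 0 < ∑ i, (c i : ℝ) ^ 2 := by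
    obtain ⟨i, hi⟩ := heℓ
    refine Finset.sum_pos' (fun _ _ => sq_nonneg _) ⟨i, Finset.mem_univ i, ?_⟩
    have hne : c i ≠ 0 := by
      intro h0
      have h1 := hcz i
      rw [hi, h0, Rat.cast_zero, zero_mul, zero_add] at h1
      have h2 := hz i
      rw [← h1] at h2
      exact linearIndepOn_iff_notMem_span.1 hβ e he (by simpa using h2)
    have : (c i : ℝ) ≠ 0 := by exact_mod_cast hne
    positivity
  refine mem_algClosureField_of_isAlgebraic (E := algClosureField X) le_rfl ?_
  let A : algClosureField X := ⟨∑ i, (c i : ℝ) ^ 2, sum_mem fun i _ => pow_mem (hcX i) 2⟩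
  let B : algClosureField X := ⟨∑ i, 2 * (c i : ℝ) * z i, sum_mem fun i _ =>
    mul_mem (mul_mem (ofNat_mem _ 2) (hcX i)) (hzX i)⟩
  let C : algClosureField X := ⟨∑ i, z i ^ 2 - lam ^ 2,
    sub_mem (sum_mem fun i _ => pow_mem (hzX i) 2) (pow_mem hlamX 2)⟩
  have hA : A ≠ 0 := fun h => hpos.ne' (congrArg Subtype.val h)
  refine ⟨Polynomial.C A * Polynomial.X ^ 2 + Polynomial.C B * Polynomial.X + Polynomial.C C,
    fun h => hA ?_, ?_⟩
  · rw [← Polynomial.leadingCoeff_quadratic (b := B) (c := C) hA, h, Polynomial.leadingCoeff_zero]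
  · simp only [map_add, map_mul, map_pow, Polynomial.aeval_X, Polynomial.aeval_C]
    change (∑ i, (c i : ℝ) ^ 2) * e ^ 2 + (∑ i, 2 * (c i : ℝ) * z i) * e +
      (∑ i, z i ^ 2 - lam ^ 2) = 0
    rw [hlam, Finset.sum_mul, Finset.sum_mul, add_sub, sub_eq_zero, ← Finset.sum_add_distrib,
      ← Finset.sum_add_distrib]
    refine Finset.sum_congr rfl fun i _ => ?_
    rw [hcz i]
    ring

/-- Lower bound for the transcendence degree generated by square roots of sums of squares of
independent logarithms of algebraic numbers. -/
lemma SchanuelConjecture.le_trdeg_add (hS : SchanuelConjecture) (K : Subfield ℝ) (d : ℕ)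
    (hK : Algebra.trdeg ℚ K = (d : Cardinal)) {m : ℕ} {ι : Fin m → Type*} [∀ j, Fintype (ι j)]
    (ℓ : ∀ j, ι j → ℝ) (U : Fin m → Submodule ℚ ℝ) (W : Set ℝ) (hU : ∀ j i, ℓ j i ∈ U j)
    (hne : ∀ j, ∃ i, ℓ j i ≠ 0) (hexp : ∀ j i, IsAlgebraic K (Real.exp (ℓ j i)))
    (hW : ∀ w ∈ W, IsAlgebraic K (Real.exp w))
    (hind : ∀ x : Fin m → ℝ, (∀ j, x j ∈ U j) → ∑ j, x j ∈ Submodule.span ℚ W → ∀ j, x j = 0)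
    (lam : Fin m → ℝ) (hlam : ∀ j, lam j ^ 2 = ∑ i, ℓ j i ^ 2)
    (F : Subfield ℝ) (hF : F ≤ algClosureField W) :
    (m : Cardinal) ≤ Algebra.trdeg F (IntermediateField.adjoin F (Set.range lam)) + d := by
  classical
  by_contra! hlt
  obtain ⟨r, hr⟩ := Cardinal.lt_aleph0.1
    (lt_of_le_of_lt (self_le_add_right _ _) (hlt.trans (Cardinal.natCast_lt_aleph0)))
  rw [hr] at hlt
  have hlt' : r + d < m := by exact_mod_cast hlt
  obtain ⟨D, hDcard, hKD⟩ := exists_finite_le_algClosureField K d hK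
  obtain ⟨Y, hYcard, hY⟩ := exists_subset_algClosureField F W hF r _ hr
  have hlamY : Set.range lam ⊆ (matroid ℚ ℝ).closure (W ∪ Y) := by
    rw [← coe_algClosureField]
    exact (IntermediateField.subset_adjoin F _).trans hY
  -- `W` may be infinite, but finitely many of its elements already account for all `lam j`;
  -- Schanuel's conjecture needs a finite family.
  obtain ⟨I, hIsub, hIfin, -, hI⟩ := Matroid.exists_subset_finite_closure_of_subset_closure
    (Set.finite_range lam) hlamY
  obtain ⟨b, hbsub, hbspan, hbind⟩ := exists_linearIndependent ℚ (I ∩ W)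
  choose β hβsub hβspan hβind using fun j => exists_linearIndependent ℚ (Set.range (ℓ j))
  have hbfin : b.Finite := (hIfin.inter_of_left W).subset hbsub
  have hβfin : ∀ j, (β j).Finite := fun j => (Set.finite_range _).subset (hβsub j)
  have := hbfin.fintype
  have := fun j => (hβfin j).fintype
  have hβne : ∀ j, (β j).Nonempty := by
    intro j
    by_contra h
    rw [Set.not_nonempty_iff_eq_empty] at h
    obtain ⟨i, hi⟩ := hne j
    have : ℓ j i ∈ Submodule.span ℚ (β j) := by
      rw [hβspan]
      exact Submodule.subset_span ⟨i, rfl⟩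
    rw [h, Submodule.span_empty, Submodule.mem_bot] at this
    exact hi this
  choose e he using hβne
  have hβU : ∀ j, ∀ x ∈ β j, x ∈ U j := fun j x hx => by
    obtain ⟨i, rfl⟩ := hβsub j hx
    exact hU j i
  let v : (Σ j, β j) ⊕ b → ℝ := Sum.elim (fun x => (x.2 : ℝ)) Subtype.val
  -- In a vanishing combination the part from the `β j` lies in the span of `W`, so `hind` kills the
  -- contribution of each `j`; independence within each `β j` and within `b` does the rest.
  have hv : LinearIndependent ℚ v := by
    rw [Fintype.linearIndependent_iff]
    intro g hg
    rw [Fintype.sum_sum_type, Fintype.sum_sigma] at hg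
    simp only [v, Sum.elim_inl, Sum.elim_inr] at hg
    have h0 := hind (fun j => ∑ x : β j, g (Sum.inl ⟨j, x⟩) • (x : ℝ))
      (fun j => sum_mem fun x _ => (U j).smul_mem _ (hβU j x x.2))
      (by
        rw [eq_neg_of_add_eq_zero_left hg]
        exact neg_mem (sum_mem fun x _ => Submodule.smul_mem _ _
          (Submodule.subset_span (hbsub x.2).2)))
    have h1 : ∑ x : b, g (Sum.inr x) • (x : ℝ) = 0 := by
      simpa only [h0, Finset.sum_const_zero, zero_add] using hg
    rintro (⟨j, x⟩ | x)
    · exact Fintype.linearIndependent_iff.1 (hβind j) (fun x => g (Sum.inl ⟨j, x⟩)) (h0 j) x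
    · exact Fintype.linearIndependent_iff.1 hbind (fun x => g (Sum.inr x)) h1 x
  let R : Finset ℝ := Finset.univ.biUnion fun j => (β j).toFinset.erase (e j)
  -- `D` controls the exponentials, `Y` and `b` the numbers `lam j`, and `R` holds each `β j` with
  -- its element `e j` removed, to be recovered from `lam j`.
  let S : Set ℝ := D ∪ Y ∪ b ∪ R
  have hDS : K ≤ algClosureField S := hKD.trans (algClosureField_mono fun x hx =>
    Or.inl (Or.inl (Or.inl hx)))
  have hbS : b ⊆ algClosureField S := fun x hx =>
    subset_algClosureField S (Or.inl (Or.inr hx))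
  have hIS : I ⊆ algClosureField S := by
    intro x hx
    rcases hIsub hx with hxW | hxY
    · refine span_subset_algClosureField hbS ?_
      rw [hbspan]
      exact Submodule.subset_span ⟨hx, hxW⟩
    · exact subset_algClosureField S (Or.inl (Or.inl (Or.inr hxY)))
  have hlamS : ∀ j, lam j ∈ algClosureField S := fun j => by
    have := hI ⟨j, rfl⟩
    rw [← mem_algClosureField] at this
    exact algClosureField_le hIS this
  have hRS : ∀ j, β j \ {e j} ⊆ algClosureField S := fun j x hx =>
    subset_algClosureField S (Or.inr (Finset.mem_coe.2 (Finset.mem_biUnion.2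
      ⟨j, Finset.mem_univ j, Finset.mem_erase.2 ⟨hx.2, Set.mem_toFinset.2 hx.1⟩⟩)))
  have heS : ∀ j, e j ∈ algClosureField S := fun j =>
    mem_algClosureField_of_sum_sq (hβind j) (he j)
      (fun i => by rw [hβspan]; exact Submodule.subset_span ⟨i, rfl⟩) (hβsub j (he j)) (hlam j)
      (hlamS j) (hRS j)
  have hβS : ∀ j, β j ⊆ algClosureField S := fun j x hx => by
    by_cases h : x = e j
    · rw [h]
      exact heS j
    · exact hRS j ⟨hx, h⟩
  let eqv := Fintype.equivFin ((Σ j, β j) ⊕ b)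
  have hmain := hS.le_encard (S := S) (hv.comp _ eqv.symm.injective)
    (fun i => by
      rcases h : eqv.symm i with ⟨j, x⟩ | x
      · simp only [Function.comp_apply, h]
        exact hβS j x.2
      · simp only [Function.comp_apply, h]
        exact hbS x.2)
    (fun i => by
      rcases h : eqv.symm i with ⟨j, x⟩ | x
      · simp only [Function.comp_apply, h]
        obtain ⟨i, hi⟩ := hβsub j x.2
        have := mem_algClosureField_of_isAlgebraic hDS (hexp j i)
        rwa [hi] at this
      · simp only [Function.comp_apply, h]
        exact mem_algClosureField_of_isAlgebraic hDS (hW x (hbsub x.2).2))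
  have hScard : S.encard ≤ ((d + r + Fintype.card b + R.card : ℕ) : ℕ∞) := by
    push_cast
    refine (Set.encard_union_le _ _).trans (add_le_add ((Set.encard_union_le _ _).trans
      (add_le_add ((Set.encard_union_le _ _).trans (add_le_add hDcard.le hYcard.le)) ?_)) ?_)
    · rw [Set.encard_eq_coe_toFinset_card, Set.toFinset_card]
    · rw [Set.encard_coe_eq_coe_finsetCard]
  have hle : Fintype.card ((Σ j, β j) ⊕ b) ≤ d + r + Fintype.card b + R.card := by
    exact_mod_cast hmain.trans hScard
  have hR : R.card + m ≤ ∑ j, Fintype.card (β j) := by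
    calc R.card + m ≤ ∑ j, ((β j).toFinset.erase (e j)).card + ∑ _j : Fin m, 1 := by
          refine add_le_add Finset.card_biUnion_le ?_
          simp
      _ = ∑ j, Fintype.card (β j) := by
          rw [← Finset.sum_add_distrib]
          refine Finset.sum_congr rfl fun j _ => ?_
          rw [Finset.card_erase_add_one (Set.mem_toFinset.2 (he j)), Set.toFinset_card]
  -- Now `∑ |β j| + |b| ≤ d + r + |b| + |R|` while `|R| + m ≤ ∑ |β j|`, so `m ≤ d + r`, against the
  -- assumption.
  rw [Fintype.card_sum, Fintype.card_sigma] at hle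
  omega

end Counting

/-! ### The logarithms attached to `Γ₂` and its length field -/

section Roots

/-- The logarithms of the absolute values of the root values at semisimple elements of `Γ`. -/
def rootLogs (G Γ : Subgroup (GL (Fin n) ℂ)) : Set ℝ :=
  {x | ∃ δ ∈ Γ, IsSemisimpleElt δ ∧ ∃ (S : Subgroup (GL (Fin n) ℂ)) (hδ : δ ∈ S),
    IsMaximalTorusOver ℝ G S ∧ ∃ α ∈ roots G S, x = Real.log ‖(α ⟨δ, hδ⟩ : ℂ)‖}

lemma rootLogs_subset_torusLogs (G Γ : Subgroup (GL (Fin n) ℂ)) :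
    rootLogs G Γ ⊆ torusLogs G Γ := by
  rintro _ ⟨δ, hδ, hss, S, hS, hmax, α, hα, rfl⟩
  exact ⟨δ, hδ, hss, S, hS, hmax, α, hα.1, rfl⟩

lemma lengthField_le_algClosureField (G Γ : Subgroup (GL (Fin n) ℂ)) :
    lengthField G Γ ≤ algClosureField (rootLogs G Γ) := by
  rw [lengthField, Subfield.closure_le]
  rintro _ ⟨δ, hδ, -, hss, rfl⟩
  by_cases h : ∃ T : Subgroup (GL (Fin n) ℂ), IsMaximalTorusOver ℝ G T ∧ δ ∈ T
  · obtain ⟨T, hT, hδT, hlam⟩ := exists_lam_eq h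
    rw [hlam]
    refine mem_algClosureField_of_isAlgebraic (E := algClosureField (rootLogs G Γ)) le_rfl ?_
    refine IsAlgebraic.of_pow two_pos ?_
    rw [Real.sq_sqrt (Finset.sum_nonneg fun _ _ => sq_nonneg _)]
    refine isAlgebraic_algebraMap (⟨_, sum_mem fun α hα => pow_mem (subset_algClosureField _ ?_) 2⟩ :
      algClosureField (rootLogs G Γ))
    exact ⟨δ, hδ, hss, T, hδT, hT, α, (Set.Finite.mem_toFinset _).1 hα, rfl⟩
  -- Without a maximal torus through `δ`, `lam` takes its default value `0`, which generates nothing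
  -- new.
  · rw [lam_eq_zero h]
    exact zero_mem _

lemma isAlgebraic_exp_log_root {K : Subfield ℝ} {G : Subgroup (GL (Fin n) ℂ)}
    {γ : GL (Fin n) ℂ} (hγ : γ ∈ rationalPoints K G) {T : Subgroup (GL (Fin n) ℂ)}
    (hT : IsTorus T) (hγT : γ ∈ T) {α : T →* ℂˣ} (hα : α ∈ roots G T) :
    IsAlgebraic K (Real.exp (Real.log ‖(α ⟨γ, hγT⟩ : ℂ)‖)) := by
  rw [Real.exp_log (norm_pos_iff.2 (Units.ne_zero _))]
  exact isAlgebraic_norm_root hγ hT hγT hα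

end Roots

end AlgGrp

theorem propositionP (schanuel : AlgGrp.SchanuelConjecture)
    (K : Subfield ℝ) (d : ℕ) (hK : Algebra.trdeg ℚ K = (d : Cardinal))
    (n₁ n₂ : ℕ) (G₁ : Subgroup (GL (Fin n₁) ℂ)) (G₂ : Subgroup (GL (Fin n₂) ℂ))
    (hG₁ : AlgGrp.IsSemisimpleGroup G₁) (hG₂ : AlgGrp.IsSemisimpleGroup G₂)
    (hG₁K : AlgGrp.IsDefinedOver K (G₁ : Set (GL (Fin n₁) ℂ)))
    (hG₂K : AlgGrp.IsDefinedOver K (G₂ : Set (GL (Fin n₂) ℂ)))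
    (Γ₁ : Subgroup (GL (Fin n₁) ℂ)) (Γ₂ : Subgroup (GL (Fin n₂) ℂ))
    (hΓ₁K : Γ₁ ≤ AlgGrp.rationalPoints K G₁) (hΓ₂K : Γ₂ ≤ AlgGrp.rationalPoints K G₂)
    (hΓ₁discrete : DiscreteTopology Γ₁) (hΓ₂discrete : DiscreteTopology Γ₂)
    (hΓ₁dense : AlgGrp.IsZariskiDenseIn Γ₁ G₁) (hΓ₂dense : AlgGrp.IsZariskiDenseIn Γ₂ G₂)
    (hΓ₁torsionFree : ∀ g ∈ Γ₁, IsOfFinOrder g → g = 1)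
    (hΓ₂torsionFree : ∀ g ∈ Γ₂, IsOfFinOrder g → g = 1)
    (m : ℕ) (γ : Fin m → GL (Fin n₁) ℂ)
    (hγ : ∀ j, γ j ∈ Γ₁ ∧ γ j ≠ 1 ∧ AlgGrp.IsSemisimpleElt (γ j))
    (hindep : AlgGrp.MultiplicativelyIndependent ℝ G₁ γ)
    (hnot : ¬ AlgGrp.WeaklyContained ℝ G₁ G₂ γ Γ₂) :
    (m : Cardinal) ≤ Algebra.trdeg (AlgGrp.lengthField G₂ Γ₂)
      (IntermediateField.adjoin (AlgGrp.lengthField G₂ Γ₂)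
        (Set.range fun j => AlgGrp.lam G₁ (γ j))) + (d : Cardinal) := by
  obtain ⟨T, hγT, hmax, hrel⟩ := hindep
  have hrat₁ : ∀ j, γ j ∈ AlgGrp.rationalPoints K G₁ := fun j => hΓ₁K (hγ j).1
  -- `lam` chooses its own tori `T' j`, which may differ from the tori `T j` carrying the
  -- independence; `AlgGrp.log_root_mem_logValues` passes from one to the other.
  choose T' hT' hγT' hlam using fun j =>
    AlgGrp.exists_lam_eq (G := G₁) (γ := γ j) ⟨T j, hmax j, hγT j⟩
  refine schanuel.le_trdeg_add K d hK
    (ι := fun j => (AlgGrp.finite_roots (G := G₁) (hT' j).maximal.prop.1).toFinset)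
    (fun j α => Real.log ‖((α : T' j →* ℂˣ) ⟨γ j, hγT' j⟩ : ℂ)‖)
    (fun j => Submodule.span ℚ (AlgGrp.logValues (T j) ⟨γ j, hγT j⟩ : Set ℝ))
    (AlgGrp.rootLogs G₂ Γ₂) (fun j α => ?_) (fun j => ?_) (fun j α => ?_) ?_ ?_ _ (fun j => ?_) _
    (AlgGrp.lengthField_le_algClosureField G₂ Γ₂)
  · exact Submodule.subset_span (AlgGrp.log_root_mem_logValues (hmax j).maximal.prop.1 (hγT' j)
      (hγT j) ((Set.Finite.mem_toFinset _).1 α.2))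
  · obtain ⟨α, hα, hne⟩ := AlgGrp.exists_root_log_ne_zero hG₁ hΓ₁discrete hΓ₁torsionFree (hγ j).1
      (hγ j).2.1 (hT' j).maximal.prop.1 (hT' j).maximal.prop.2 (hγT' j)
    exact ⟨⟨α, (Set.Finite.mem_toFinset _).2 hα⟩, hne⟩
  · exact AlgGrp.isAlgebraic_exp_log_root (hrat₁ j) (hT' j).maximal.prop.1 (hγT' j)
      ((Set.Finite.mem_toFinset _).1 α.2)
  · rintro _ ⟨δ, hδ, -, S, hδS, hS, α, hα, rfl⟩
    exact AlgGrp.isAlgebraic_exp_log_root (hΓ₂K hδ) hS.maximal.prop.1 hδS hα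
  · intro x hx hsum
    exact AlgGrp.eq_zero_of_sum_mem_span hγT hmax hrel hnot
      (fun j => AlgGrp.conjGL_eq_of_mem_rationalPoints (hrat₁ j))
      (fun δ hδ => AlgGrp.conjGL_eq_of_mem_rationalPoints (hΓ₂K hδ)) hx
      (Submodule.span_mono (AlgGrp.rootLogs_subset_torusLogs G₂ Γ₂) hsum)
  · rw [hlam j, Real.sq_sqrt (Finset.sum_nonneg fun _ _ => sq_nonneg _)]
    exact (Finset.sum_coe_sort _ fun α : T' j →* ℂˣ =>
      (Real.log ‖(α ⟨γ j, hγT' j⟩ : ℂ)‖) ^ 2).symm
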